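/- All graphs are finite and simple. For a graph $G$, a set $S\subseteq V(G)$ is dominating if every vertex of $G$ lies in the closed neighbourhood $N[u]$ of some $u\in S$; $\gamma(G)$ is the minimum cardinality of a dominating set, and a $\gamma$-set is a dominating set of cardinality $\gamma(G)$. The power of $G$ is $\pi(G)=\min_{D}\max_{v\in V(G)}|D\cap N[v]|$, the minimum being over all $\gamma$-sets $D$ of $G$. A graph is $F$-free if it has no induced subgraph isomorphic to $F$; $K_r$ is the complete graph on $r$ vertices, $P_5$ is the path on $5$ vertices, and $G\square H$ is the Cartesian product. Proposition. Let $G$ be a connected graph. (1) If $G$ is $K_4$-free and $P_5$-free, then $\gamma(G\square H)\ge\gamma(G)\gamma(H)$ for every graph $H$. (2) If $G$ is $K_r$-free and $P_5$-free for some integer $r>4$, then $\pi(G)\le r-1$. -/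

import Mathlib

namespace SimpleGraph

/-- `G` is `H`-free: no induced subgraph of `G` is isomorphic to `H`. -/
def InducedFree {U V : Type*} (H : SimpleGraph U) (G : SimpleGraph V) : Prop :=
  ¬ H.IsIndContained G

/-- The closed neighbourhood `N[v]`. -/
def closedNbhd {V : Type*} (G : SimpleGraph V) (v : V) : Set V :=
  insert v (G.neighborSet v)

/-- `S` dominates `G`: the closed neighbourhoods of the vertices of `S` cover all vertices. -/
def Dominates {V : Type*} (G : SimpleGraph V) (S : Finset V) : Prop :=
  ∀ v : V, ∃ u ∈ S, v ∈ G.closedNbhd u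

/-- The domination number `γ(G)`. For a finite graph the set of cardinalities is nonempty, since
the set of all vertices dominates, so the infimum is a minimum. -/
noncomputable def dominationNumber {V : Type*} (G : SimpleGraph V) : ℕ :=
  sInf {n : ℕ | ∃ S : Finset V, G.Dominates S ∧ S.card = n}

/-- A `γ`-set: a dominating set of minimum cardinality. -/
def IsGammaSet {V : Type*} (G : SimpleGraph V) (D : Finset V) : Prop :=
  G.Dominates D ∧ D.card = G.dominationNumber

open Classical in
/-- The allegiance of `D`: the maximum over all vertices `v` of `|D ∩ N[v]|`. -/
noncomputable def allegiance {V : Type*} [Fintype V] (G : SimpleGraph V) (D : Finset V) : ℕ :=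
  Finset.univ.sup fun v : V => (D.filter fun u => u ∈ G.closedNbhd v).card

/-- The power `π(G)`: the minimum of the allegiances of the `γ`-sets of `G`. -/
noncomputable def power {V : Type*} [Fintype V] (G : SimpleGraph V) : ℕ :=
  sInf {a : ℕ | ∃ D : Finset V, G.IsGammaSet D ∧ G.allegiance D = a}

end SimpleGraph

/-! For (2), a minimum connected dominating set of a connected `P₅`-free graph is a clique or has at
most three vertices (`IsMinCDS.card_le_three`). Hence γ(G) ≤ r - 1 as soon as r ≥ 4, and π(G) ≤ γ(G)
always.

For (1) this leaves γ(G) ≤ 3. A dominating set of G □ H is cut into fibres over the vertices of H,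
and each fibre receives at most as many tokens as it has vertices. If each of γ(G) tokens occurs on
a dominating set of H, counting tokens gives the inequality. Tokens stand for disjoint classes of
vertices of G: a fibre lacking a token should leave a vertex of the class undominated, and that
vertex then lies in a neighbouring fibre, which carries the token. For γ(G) = 2 the classes are a
maximal clique and its complement. For γ(G) = 3 they are a vertex `v`, a maximal clique `K` without
neighbours of `v`, and the remaining non-neighbours of `v`. Neighbours of `v` have no class, so the
scheme can fail near some fibres; each of these keeps a spare token, and a König argument
(`exists_dominating_pair`) shows that the spares repair both defective tokens.

If no such `K`, `v` existed, every edge would lie in a triangle and every triangle would dominate.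
Such a graph has an induced five-cycle (`exists_inducedC5`), every vertex is a twin or a hat of it,
and two suitable vertices dominate (`false_of_inducedC5`), against γ(G) = 3. -/

namespace SimpleGraph

/-! ### Graphs whose triangles dominate: finding an induced five-cycle. -/

/-- A graph without induced `P₅` and `K₄` in which every edge lies in a triangle, every triangle is
dominating and no two vertices dominate. -/
structure TriangleDominated {V : Type*} (G : SimpleGraph V) : Prop where
  p5 : ∀ a b c d e, G.Adj a b → G.Adj b c → G.Adj c d → G.Adj d e →
    G.Adj a c ∨ G.Adj a d ∨ G.Adj a e ∨ G.Adj b d ∨ G.Adj b e ∨ G.Adj c e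
  k4 : ∀ a b c d, G.Adj a b → G.Adj a c → G.Adj a d → G.Adj b c → G.Adj b d → ¬ G.Adj c d
  tri : ∀ a b, G.Adj a b → ∃ c, G.Adj a c ∧ G.Adj b c
  dom : ∀ a b c, G.Adj a b → G.Adj a c → G.Adj b c → ∀ v, G.Adj v a ∨ G.Adj v b ∨ G.Adj v c
  miss : ∀ x y, ∃ z, z ≠ x ∧ z ≠ y ∧ ¬ G.Adj z x ∧ ¬ G.Adj z y

/-- The vertices `a, b, c, d, e` form, in this order, an induced cycle. -/
def IsInducedC5 {V : Type*} (G : SimpleGraph V) (a b c d e : V) : Prop :=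
  G.Adj a b ∧ G.Adj b c ∧ G.Adj c d ∧ G.Adj d e ∧ G.Adj e a ∧
    ¬ G.Adj a c ∧ ¬ G.Adj b d ∧ ¬ G.Adj c e ∧ ¬ G.Adj d a ∧ ¬ G.Adj e b

namespace IsInducedC5

variable {V : Type*} {G : SimpleGraph V} {a b c d e : V}

theorem rotate (h : G.IsInducedC5 a b c d e) : G.IsInducedC5 b c d e a := by
  obtain ⟨h1, h2, h3, h4, h5, h6, h7, h8, h9, h10⟩ := h
  exact ⟨h2, h3, h4, h5, h1, h7, h8, h9, h10, h6⟩

theorem reflect (h : G.IsInducedC5 a b c d e) : G.IsInducedC5 a e d c b := by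
  obtain ⟨h1, h2, h3, h4, h5, h6, h7, h8, h9, h10⟩ := h
  refine ⟨h5.symm, h4.symm, h3.symm, h2.symm, h1.symm, ?_, ?_, ?_, ?_, ?_⟩ <;>
    rw [adj_comm] <;> assumption

end IsInducedC5

namespace TriangleDominated

variable {V : Type*} {G : SimpleGraph V}

/-- A vertex `m` missed by `a` and `a'` is adjacent to `b` or `c`. If to `b`, then `m, b, a, a', c'`
span an induced path or five-cycle, depending on whether `m` sees `c'`; the case of `c` is
symmetric. -/
theorem exists_inducedC5_of_prism (hG : G.TriangleDominated) {a b c a' b' c' : V}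
    (hab : G.Adj a b) (hac : G.Adj a c)
    (hbc : G.Adj b c) (haa : G.Adj a a')
    (hab' : ¬ G.Adj a b') (hac' : ¬ G.Adj a c') (hba' : ¬ G.Adj b a') (hbc' : ¬ G.Adj b c')
    (hca' : ¬ G.Adj c a') (hcb' : ¬ G.Adj c b') (h1 : G.Adj a' b') (h2 : G.Adj a' c')
    (h3 : G.Adj b' c') : ∃ a b c d e, G.IsInducedC5 a b c d e := by
  by_contra! hno
  obtain ⟨m, -, -, hma, hma'⟩ := hG.miss a a'
  have d1 := hG.dom a b c hab hac hbc m
  have e1 := hno m b a a' c'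
  have e2 := hno m c a a' b'
  have e3 := hG.p5 m b a a' c'
  have e4 := hG.p5 m c a a' b'
  have e5 := hG.dom a' b' c' h1 h2 h3 m
  have sym : ∀ x y, G.Adj x y → G.Adj y x := fun _ _ h => h.symm
  unfold IsInducedC5 at e1 e2
  clear hno hG
  grind

/-- A vertex `m` missed by `a` and `d` sees `a'`, since the triangle `a, d, a'` dominates. Without
an induced five-cycle it then sees `c` and `c'`, hence `b'` by the triangle `m, c, c'`, and `a, d,
b', m, c` is an induced five-cycle. -/
theorem exists_inducedC5_of_net (hG : G.TriangleDominated) {a b c a' b' c' d : V}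
    (hab : G.Adj a b) (hac : G.Adj a c) (haa : G.Adj a a') (hcc : G.Adj c c')
    (hab' : ¬ G.Adj a b') (hac' : ¬ G.Adj a c')
    (hca' : ¬ G.Adj c a') (hcb' : ¬ G.Adj c b') (h2 : ¬ G.Adj a' c')
    (h3 : ¬ G.Adj b' c') (had : G.Adj a d) (hda : G.Adj a' d) (hdb : G.Adj d b)
    (hdc : ¬ G.Adj d c) (hdb' : G.Adj d b') (hdc' : G.Adj d c') :
    ∃ a b c d e, G.IsInducedC5 a b c d e := by
  by_contra! hno
  obtain ⟨m, -, -, hma, hmd⟩ := hG.miss a d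
  have mb := hG.dom a d b had hab hdb m
  have ma' := hG.dom a d a' had haa hda.symm m
  have e3 := hG.p5 m a' a c c'
  have e4 := hno m a' a c c'
  have e5 := hno c' d a' m c

  have e6 := fun h1 h2 h3 => hG.dom m c c' h1 h2 h3 b'
  have e7 := hno a d b' m c
  have sym : ∀ x y, G.Adj x y → G.Adj y x := fun _ _ h => h.symm
  unfold IsInducedC5 at e4 e5 e7
  clear hno hG
  grind


/-- Each vertex of a triangle `a, b, c` gets a pendant neighbour missed by the other two. The
pendants form a triangle (prism) or are independent (net). -/
theorem exists_inducedC5 (hG : G.TriangleDominated) {a b : V} (hab : G.Adj a b) :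
    ∃ a b c d e, G.IsInducedC5 a b c d e := by
  by_contra hno
  obtain ⟨c, hac, hbc⟩ := hG.tri a b hab
  obtain ⟨a', -, -, hba', hca'⟩ := hG.miss b c
  obtain ⟨b', -, -, hab', hcb'⟩ := hG.miss a c
  obtain ⟨c', -, -, hac', hbc'⟩ := hG.miss a b
  have sym : ∀ x y, G.Adj x y → G.Adj y x := fun _ _ h => h.symm
  have sym' : ∀ x y, ¬ G.Adj x y → ¬ G.Adj y x := fun _ _ h h' => h h'.symm
  have haa := hG.dom a b c hab hac hbc a'
  have hbb := hG.dom a b c hab hac hbc b'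
  have hcc := hG.dom a b c hab hac hbc c'
  -- One edge between pendants forces a second, so either all three edges are present or none.
  have k1 : ∀ {x y z x' y' z' : V}, G.Adj x y → G.Adj x z → G.Adj y z → G.Adj x x' →
      G.Adj y y' → G.Adj z z' → ¬ G.Adj y' x → ¬ G.Adj z' x → ¬ G.Adj x' y → ¬ G.Adj z' y →
      ¬ G.Adj x' z → ¬ G.Adj y' z → G.Adj x' y' → G.Adj x' z' := by
    intro x y z x' y' z' _ _ _ _ _ _ _ _ _ _ _ _ _
    by_contra h
    have e1 := hG.p5 z' z x x' y'
    have e2 := hG.p5 z' z y y' x'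
    have e3 : ¬ G.IsInducedC5 x' x z z' y' := fun h => hno ⟨_, _, _, _, _, h⟩
    unfold IsInducedC5 at e3
    clear hno hG
    grind
  have haa : G.Adj a a' := by grind
  have hbb : G.Adj b b' := by grind
  have hcc : G.Adj c c' := by grind
  have e1 := k1 hab hac hbc haa hbb hcc hab' hac' hba' hbc' hca' hcb'
  have e2 := k1 hab.symm hbc hac hbb haa hcc hba' hbc' hab' hac' hcb' hca'
  have e3 := k1 hac hab hbc.symm haa hcc hbb hac' hab' hca' hcb' hba' hbc'
  have e4 := k1 hbc hab.symm hac.symm hbb hcc haa hbc' hba' hcb' hca' hab' hac'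
  by_cases h1 : G.Adj a' b'
  · exact hno (hG.exists_inducedC5_of_prism hab hac hbc haa (sym' _ _ hab') (sym' _ _ hac')
      (sym' _ _ hba') (sym' _ _ hbc') (sym' _ _ hca') (sym' _ _ hcb') h1 (e1 h1) (e2 h1.symm))
  have h2 : ¬ G.Adj a' c' := fun h => h1 (e3 h)
  have h3 : ¬ G.Adj b' c' := fun h => h1 (e4 h).symm
  -- `d` sees `b'` and `c'` because `a, a', d` dominates. It cannot see both `b` and `c` by
  -- `K₄`-freeness, and if it sees neither, `b', b, c, c', d` is an induced five-cycle.
  obtain ⟨d, had, hda⟩ := hG.tri a a' haa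
  have d1 := hG.dom a a' d haa had hda b'
  have d2 := hG.dom a a' d haa had hda c'
  have d3 := hG.k4 a b c d
  have d4 : ¬ G.IsInducedC5 b' b c c' d := fun h => hno ⟨_, _, _, _, _, h⟩
  have d5 := fun x y z w => hno (hG.exists_inducedC5_of_net hab hac haa hcc
    (sym' _ _ hab') (sym' _ _ hac') (sym' _ _ hca') (sym' _ _ hcb') h2 h3 had hda x y z w)
  have d6 := fun x y z w => hno (hG.exists_inducedC5_of_net hac hab haa hbb
    (sym' _ _ hac') (sym' _ _ hab') (sym' _ _ hba') (sym' _ _ hbc') h1 (sym' _ _ h3) had hda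
    x y z w)
  unfold IsInducedC5 at d4
  clear hno hG k1
  grind
end TriangleDominated
end SimpleGraph

/-! ### Adjacency of vertices to an induced five-cycle. -/

namespace SimpleGraph

/-- `u` is adjacent, among the vertices of the cycle `a, b, c, d, e`, to exactly `a, b, d`. -/
def IsHat {V : Type*} (G : SimpleGraph V) (a b c d e u : V) : Prop :=
  G.Adj u a ∧ G.Adj u b ∧ ¬ G.Adj u c ∧ G.Adj u d ∧ ¬ G.Adj u e

/-- `u` is adjacent, among the vertices of the cycle `a, b, c, d, e`, to exactly the two
neighbours `e, b` of `a`. -/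
def IsTwin {V : Type*} (G : SimpleGraph V) (a b c d e u : V) : Prop :=
  ¬ G.Adj u a ∧ G.Adj u b ∧ ¬ G.Adj u c ∧ ¬ G.Adj u d ∧ G.Adj u e

theorem IsInducedC5.replace {V : Type*} {G : SimpleGraph V} {a b c d e u : V}
    (h : G.IsInducedC5 a b c d e) (hu : G.IsTwin a b c d e u) : G.IsInducedC5 u b c d e := by
  obtain ⟨h1, h2, h3, h4, h5, h6, h7, h8, h9, h10⟩ := h
  obtain ⟨-, u1, u2, u3, u4⟩ := hu
  exact ⟨u1, h2, h3, h4, u4.symm, u2, h7, h8, fun h => u3 h.symm, h10⟩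

theorem IsInducedC5.isTwin_self {V : Type*} {G : SimpleGraph V} {a b c d e : V}
    (h : G.IsInducedC5 a b c d e) : G.IsTwin a b c d e a := by
  obtain ⟨h1, h2, h3, h4, h5, h6, h7, h8, h9, h10⟩ := h
  exact ⟨G.irrefl, h1, h6, fun h => h9 h.symm, h5.symm⟩

namespace TriangleDominated

variable {V : Type*} {G : SimpleGraph V} {a b c d e : V}

/-- Otherwise the two paths leaving `u` through `a` around the cycle force `u` to see both `e` and
`b`, and then the triangle `u, a, b` fails to dominate `d`. -/
theorem adj_or_adj_of_adj (hG : G.TriangleDominated) (hC : G.IsInducedC5 a b c d e) {u : V}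
    (h : G.Adj u a) : G.Adj u c ∨ G.Adj u d := by
  obtain ⟨h1, h2, h3, h4, h5, h6, h7, h8, h9, h10⟩ := hC
  have e1 := hG.p5 u a e d c
  have e2 := hG.p5 u a b c d
  have e3 := fun x y z => hG.dom u a b x y z d
  have sym : ∀ x y, G.Adj x y → G.Adj y x := fun _ _ h => h.symm
  clear hG
  grind

theorem adj_of_adj_of_adj (hG : G.TriangleDominated) (hC : G.IsInducedC5 a b c d e) {u : V}
    (h : G.Adj u c) (h' : G.Adj u d) : G.Adj u a := by
  obtain ⟨h1, h2, h3, h4, h5, h6, h7, h8, h9, h10⟩ := hC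
  have e3 := hG.dom u c d h h' h3 a
  have sym : ∀ x y, G.Adj x y → G.Adj y x := fun _ _ h => h.symm
  clear hG
  grind

/-- The possible adjacencies of a vertex to an induced five-cycle. -/
theorem pattern (hG : G.TriangleDominated) (hC : G.IsInducedC5 a b c d e) (u : V) :
    ((G.Adj u a → G.Adj u c ∨ G.Adj u d) ∧ (G.Adj u b → G.Adj u d ∨ G.Adj u e) ∧
      (G.Adj u c → G.Adj u e ∨ G.Adj u a) ∧ (G.Adj u d → G.Adj u a ∨ G.Adj u b) ∧
      (G.Adj u e → G.Adj u b ∨ G.Adj u c)) ∧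
    (G.Adj u c → G.Adj u d → G.Adj u a) ∧ (G.Adj u d → G.Adj u e → G.Adj u b) ∧
      (G.Adj u e → G.Adj u a → G.Adj u c) ∧ (G.Adj u a → G.Adj u b → G.Adj u d) ∧
      (G.Adj u b → G.Adj u c → G.Adj u e) :=
  ⟨⟨hG.adj_or_adj_of_adj hC, hG.adj_or_adj_of_adj hC.rotate, hG.adj_or_adj_of_adj hC.rotate.rotate,
    hG.adj_or_adj_of_adj hC.rotate.rotate.rotate,
    hG.adj_or_adj_of_adj hC.rotate.rotate.rotate.rotate⟩,
    hG.adj_of_adj_of_adj hC, hG.adj_of_adj_of_adj hC.rotate, hG.adj_of_adj_of_adj hC.rotate.rotate,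
    hG.adj_of_adj_of_adj hC.rotate.rotate.rotate,
    hG.adj_of_adj_of_adj hC.rotate.rotate.rotate.rotate⟩

theorem hat_adj_hat (hG : G.TriangleDominated) (hC : G.IsInducedC5 a b c d e) {t s : V}
    (ht : G.IsHat a b c d e t) (hs : G.IsHat b c d e a s) : G.Adj t s := by
  obtain ⟨h1, h2, h3, h4, h5, h6, h7, h8, h9, h10⟩ := hC
  obtain ⟨t1, t2, t3, t4, t5⟩ := ht
  obtain ⟨s1, s2, s3, s4, s5⟩ := hs
  have e1 := hG.p5 t a e s c
  have sym : ∀ x y, G.Adj x y → G.Adj y x := fun _ _ h => h.symm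
  clear hG
  grind

theorem adj_hat (hG : G.TriangleDominated) (hC : G.IsInducedC5 a b c d e) {t u : V}
    (ht : G.IsHat a b c d e t) (ha : ¬ G.Adj u a) (hb : ¬ G.Adj u b) : G.Adj u t := by
  have := hG.dom t a b ht.1 ht.2.1 hC.1 u
  tauto

/-- A vertex `m` missed by `e` and `t` is forced to be a hat on `ab` or `cd`. Hats on consecutive
edges are adjacent, so `m` would see `t`. -/
theorem no_hub_aux (hG : G.TriangleDominated) (hC : G.IsInducedC5 a b c d e) {h t : V}
    (ha : G.Adj h a) (hd : G.Adj h d) (he : G.Adj h e)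
    (ht : G.IsHat b c d e a t) (hht : ¬ G.Adj t h) : False := by
  obtain ⟨m, -, -, hme, hmt⟩ := hG.miss e t
  have hp := hG.pattern hC m
  have e1 := hG.adj_hat hC.rotate (u := m) ht
  have e2 : G.IsHat a b c d e m → G.Adj m t := fun h => hG.hat_adj_hat hC h ht
  have e3 : G.IsHat c d e a b m → G.Adj t m := fun h => hG.hat_adj_hat hC.rotate ht h
  obtain ⟨h1, h2, h3, h4, h5, h6, h7, h8, h9, h10⟩ := hC
  have e4 := hG.dom h d e hd he h4 m
  have e5 := hG.dom h a e ha he h5.symm m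
  have e6 := fun x y => hG.dom h a m ha x y t
  have e7 := fun x y => hG.dom h d m hd x y t
  obtain ⟨t1, t2, t3, t4, t5⟩ := ht
  unfold IsHat at e2 e3
  have sym : ∀ x y, G.Adj x y → G.Adj y x := fun _ _ h => h.symm
  clear hG
  grind

/-- The triangles through `h` make a vertex `t` missed by `h` and `a` see an end of every edge of
the cycle. So `t` is a hat on `bc` or `de`, and `no_hub_aux` excludes both, up to reflection. -/
theorem no_hub (hG : G.TriangleDominated) (hC : G.IsInducedC5 a b c d e) {h : V}
    (ha : G.Adj h a) (hb : G.Adj h b) (hc : G.Adj h c) (hd : G.Adj h d) (he : G.Adj h e) :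
    False := by
  obtain ⟨t, -, -, hth, hta⟩ := hG.miss h a
  have hp := hG.pattern hC t
  have e1 := fun x => hG.no_hub_aux (t := t) hC ha hd he x hth
  have e2 := fun x => hG.no_hub_aux (t := t) hC.reflect ha hc hb x hth
  obtain ⟨h1, h2, h3, h4, h5, h6, h7, h8, h9, h10⟩ := hC
  have e4 := hG.dom h a b ha hb h1 t
  have e5 := hG.dom h b c hb hc h2 t
  have e6 := hG.dom h c d hc hd h3 t
  have e7 := hG.dom h d e hd he h4 t
  have e8 := hG.dom h a e ha he h5.symm t
  unfold IsHat at e1 e2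
  have sym : ∀ x y, G.Adj x y → G.Adj y x := fun _ _ h => h.symm
  clear hG
  grind

theorem exists_isHat (hG : G.TriangleDominated) (hC : G.IsInducedC5 a b c d e) :
    ∃ t, G.IsHat a b c d e t := by
  obtain ⟨t, ta, tb⟩ := hG.tri a b hC.1
  have hp := hG.pattern hC t
  have e1 := fun x y z w s => hG.no_hub hC (h := t) x y z w s
  refine ⟨t, ?_⟩
  unfold IsHat
  have sym : ∀ x y, G.Adj x y → G.Adj y x := fun _ _ h => h.symm
  clear hG
  grind

/-- Hats on the five edges form a five-cycle, all of whose vertices see `z`. `K₄`-freeness makes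
that cycle induced, so `z` is a hub of it. -/
theorem not_isolated (hG : G.TriangleDominated) (hC : G.IsInducedC5 a b c d e) {z : V}
    (ha : ¬ G.Adj z a) (hb : ¬ G.Adj z b) (hc : ¬ G.Adj z c) (hd : ¬ G.Adj z d)
    (he : ¬ G.Adj z e) : False := by
  obtain ⟨t0, ht0⟩ := hG.exists_isHat hC
  obtain ⟨t1, ht1⟩ := hG.exists_isHat hC.rotate
  obtain ⟨t2, ht2⟩ := hG.exists_isHat hC.rotate.rotate
  obtain ⟨t3, ht3⟩ := hG.exists_isHat hC.rotate.rotate.rotate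
  obtain ⟨t4, ht4⟩ := hG.exists_isHat hC.rotate.rotate.rotate.rotate
  have a0 := hG.adj_hat hC ht0 ha hb
  have a1 := hG.adj_hat hC.rotate ht1 hb hc
  have a2 := hG.adj_hat hC.rotate.rotate ht2 hc hd
  have a3 := hG.adj_hat hC.rotate.rotate.rotate ht3 hd he
  have a4 := hG.adj_hat hC.rotate.rotate.rotate.rotate ht4 he ha
  have b0 := hG.hat_adj_hat hC ht0 ht1
  have b1 := hG.hat_adj_hat hC.rotate ht1 ht2
  have b2 := hG.hat_adj_hat hC.rotate.rotate ht2 ht3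
  have b3 := hG.hat_adj_hat hC.rotate.rotate.rotate ht3 ht4
  have b4 := hG.hat_adj_hat hC.rotate.rotate.rotate.rotate ht4 ht0
  have key : ∀ {x y w}, G.Adj z x → G.Adj z y → G.Adj z w → G.Adj x y → G.Adj y w →
      ¬ G.Adj x w := fun h1 h2 h3 h4 h5 h6 => hG.k4 _ _ _ _ h1 h2 h3 h4 h6 h5
  exact hG.no_hub ⟨b0, b1, b2, b3, b4, key a0 a1 a2 b0 b1, key a1 a2 a3 b1 b2,
    key a2 a3 a4 b2 b3, key a3 a4 a0 b3 b4, key a4 a0 a1 b4 b0⟩ a0 a1 a2 a3 a4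

theorem twin_adj_twin (hG : G.TriangleDominated) (hC : G.IsInducedC5 a b c d e) {u w : V}
    (hu : G.IsTwin a b c d e u) (hw : G.IsTwin b c d e a w) : G.Adj w u :=
  (hG.adj_or_adj_of_adj (hC.replace hu).rotate.rotate hw.2.1).resolve_left hw.2.2.2.1

theorem not_twin_adj_twin (hG : G.TriangleDominated) (hC : G.IsInducedC5 a b c d e) {u w : V}
    (hu : G.IsTwin a b c d e u) (hw : G.IsTwin a b c d e w) : ¬ G.Adj w u :=
  fun h => (hG.adj_or_adj_of_adj (hC.replace hu) h).elim hw.2.2.1 hw.2.2.2.1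

theorem hat_adj_twin (hG : G.TriangleDominated) (hC : G.IsInducedC5 a b c d e) {u t : V}
    (hu : G.IsTwin a b c d e u) (ht : G.IsHat c d e a b t) : G.Adj t u :=
  hG.adj_of_adj_of_adj (hC.replace hu) ht.1 ht.2.1

/-- Every vertex is a twin or a hat of an induced five-cycle. -/
theorem isTwin_or_isHat (hG : G.TriangleDominated) (hC : G.IsInducedC5 a b c d e) (u : V) :
    (G.IsTwin a b c d e u ∨ G.IsTwin b c d e a u ∨ G.IsTwin c d e a b u ∨
      G.IsTwin d e a b c u ∨ G.IsTwin e a b c d u) ∨ G.IsHat a b c d e u ∨ G.IsHat b c d e a u ∨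
      G.IsHat c d e a b u ∨ G.IsHat d e a b c u ∨ G.IsHat e a b c d u := by
  have h1 := hG.pattern hC u
  have h2 := fun x y z w s => hG.no_hub hC (h := u) x y z w s
  have h3 := fun x y z w s => hG.not_isolated hC (z := u) x y z w s
  unfold IsTwin IsHat
  clear hG
  grind

end TriangleDominated
end SimpleGraph

/-! ### Twins and hats: two vertices dominate. -/

namespace SimpleGraph
namespace TriangleDominated

variable {V : Type*} {G : SimpleGraph V} {a b c d e : V}

/-- With `e` replaced by `u` in the cycle, `t` cannot see `u`; then `x, u, a, t, c` has no chord
other than `tx`. -/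
theorem hat_adj_of_twin_adj (hG : G.TriangleDominated) (hC : G.IsInducedC5 a b c d e) {u x t : V}
    (hu : G.IsTwin e a b c d u) (hx : G.IsTwin c d e a b x) (hux : G.Adj u x)
    (ht : G.IsHat c d e a b t) : G.Adj t x := by
  have hxc := hG.not_twin_adj_twin hC.rotate.rotate hC.rotate.rotate.isTwin_self hx
  have htu := hG.adj_of_adj_of_adj (u := t)
    (hC.rotate.rotate.rotate.rotate.replace hu).rotate.rotate
  have e0 := hC.2.2.2.2.2.1
  have e1 := hG.p5 x u a t c
  obtain ⟨u1, u2, u3, u4, u5⟩ := hu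
  obtain ⟨x1, x2, x3, x4, x5⟩ := hx
  obtain ⟨t1, t2, t3, t4, t5⟩ := ht
  have sym : ∀ x y, G.Adj x y → G.Adj y x := fun _ _ h => h.symm
  clear hG
  grind

theorem _root_.SimpleGraph.IsHat.reflect {u : V} (h : G.IsHat c d e a b u) :
    G.IsHat d c b a e u := by
  obtain ⟨h1, h2, h3, h4, h5⟩ := h
  exact ⟨h2, h1, h5, h4, h3⟩

theorem _root_.SimpleGraph.IsTwin.reflect {u : V} (h : G.IsTwin a b c d e u) :
    G.IsTwin a e d c b u := by
  obtain ⟨h1, h2, h3, h4, h5⟩ := h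
  exact ⟨h1, h5, h4, h3, h2⟩

theorem twin_of_hat_replace (hG : G.TriangleDominated) (hC : G.IsInducedC5 a b c d e) {u : V}
    (h1 : G.Adj u a) (h2 : ¬ G.Adj u e) (h3 : ¬ G.Adj u b) :
    G.IsHat c d e a b u ∨ G.IsTwin b c d e a u ∨ G.IsTwin e a b c d u := by
  have := hG.pattern hC u
  unfold IsHat IsTwin
  clear hG
  grind

/-- A twin of `c` and a twin of `d` have a common neighbour among the hats on `cd`. -/
theorem exists_isHat_adj_adj (hG : G.TriangleDominated) (hC : G.IsInducedC5 a b c d e) {x y : V}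
    (hx : G.IsTwin c d e a b x) (hy : G.IsTwin d e a b c y) :
    ∃ t, G.IsHat c d e a b t ∧ G.Adj t x ∧ G.Adj t y := by
  have hyx := hG.twin_adj_twin hC.rotate.rotate hx hy
  have hcx : ∀ {w}, G.IsTwin d e a b c w → G.Adj w x := hG.twin_adj_twin hC.rotate.rotate hx
  have hC1 := hC.rotate.rotate.replace hx
  have hC2 := hC1.rotate.replace (u := y) ⟨hy.1, hy.2.1, hy.2.2.1, hy.2.2.2.1, hyx⟩
  have hC3 := hC.rotate.rotate.rotate.replace hy
  obtain ⟨t0, ht0⟩ := hG.exists_isHat hC.rotate.rotate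
  -- Hats on `xy`, `cy` and `xd` in the modified cycles. Each is either a hat on `cd` or a twin of
  -- `b` or `e`; in the latter case it makes every hat on `cd` adjacent to `y` or to `x`.
  obtain ⟨u, hu1, hu2, hu3, hu4, hu5⟩ := hG.exists_isHat hC2.rotate.rotate.rotate.rotate
  obtain ⟨w, hw1, hw2, hw3, hw4, hw5⟩ := hG.exists_isHat hC3.rotate.rotate.rotate.rotate
  obtain ⟨z, hz1, hz2, hz3, hz4, hz5⟩ := hG.exists_isHat hC1
  have A : ∀ {u}, G.IsTwin e a b c d u → G.Adj u x → ∀ {t}, G.IsHat c d e a b t → G.Adj t x :=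
    fun h1 h2 _ h3 => hG.hat_adj_of_twin_adj hC h1 hx h2 h3
  have B : ∀ {u}, G.IsTwin b c d e a u → G.Adj u y → ∀ {t}, G.IsHat c d e a b t → G.Adj t y :=
    fun h1 h2 _ h3 => hG.hat_adj_of_twin_adj hC.reflect h1.reflect hy.reflect h2 h3.reflect
  rcases hG.twin_of_hat_replace hC hu4 hu3 hu5 with h | h | h
  · exact ⟨u, h, hu1, hu2⟩
  · rcases hG.twin_of_hat_replace hC hz4 hz3 hz5 with h' | h' | h'
    · exact ⟨z, h', hz1, B h hu2 h'⟩
    · exact absurd hz2 h'.2.2.1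
    · exact ⟨t0, ht0, A h' hz1 ht0, B h hu2 ht0⟩
  · rcases hG.twin_of_hat_replace hC hw4 hw3 hw5 with h' | h' | h'
    · exact ⟨w, h', A h hu1 h', hw2⟩
    · exact ⟨t0, ht0, A h hu1 ht0, B h' hw2 ht0⟩
    · exact absurd hw1 h'.2.2.2.1

/-- Between twins of `c` and hats on `cd`, neighbourhoods are nested: two hats are non-adjacent by
`K₄`-freeness, so a violation gives the induced path `x, t, a, t', x'`. -/
theorem hat_nested (hG : G.TriangleDominated) (hC : G.IsInducedC5 a b c d e) {x x' t t' : V}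
    (hx : G.IsTwin c d e a b x) (hx' : G.IsTwin c d e a b x') (ht : G.IsHat c d e a b t)
    (ht' : G.IsHat c d e a b t') (h : G.Adj t x) (h' : G.Adj t' x') :
    G.Adj t x' ∨ G.Adj t' x := by
  have e1 := hG.p5 x t a t' x'
  have e2 := hG.not_twin_adj_twin hC.rotate.rotate hx hx'
  have e3 : ¬ G.Adj t t' := fun h => hG.k4 t t' c d h ht.1 ht.2.1 ht'.1 ht'.2.1 hC.2.2.1
  obtain ⟨x1, x2, x3, x4, x5⟩ := hx
  obtain ⟨x1', x2', x3', x4', x5'⟩ := hx'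
  obtain ⟨t1, t2, t3, t4, t5⟩ := ht
  obtain ⟨t1', t2', t3', t4', t5'⟩ := ht'
  have sym : ∀ x y, G.Adj x y → G.Adj y x := fun _ _ h => h.symm
  clear hG hC
  grind

theorem exists_minimal_twin [Finite V] (hG : G.TriangleDominated) (hC : G.IsInducedC5 a b c d e) :
    ∃ x, G.IsTwin c d e a b x ∧ ∀ t, G.IsHat c d e a b t → G.Adj t x →
      ∀ x', G.IsTwin c d e a b x' → G.Adj t x' := by
  obtain ⟨x, hx, hmin⟩ := Set.Finite.exists_minimalFor
    (fun x => {t | G.IsHat c d e a b t ∧ G.Adj t x}) {x | G.IsTwin c d e a b x} (Set.toFinite _)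
    ⟨c, hC.rotate.rotate.isTwin_self⟩
  refine ⟨x, hx, fun t ht htx x' hx' => ?_⟩
  by_contra h
  exact h (hmin hx' (fun t' ht' => ⟨ht'.1, (hG.hat_nested hC hx hx' ht ht'.1 htx
    ht'.2).resolve_left h⟩) ⟨ht, htx⟩).2

/-- The dominating pair is `a` and a hat `u` on `cd` that sees minimal twins of both `c` and `d`,
hence all twins of `c` and `d`. Of the remaining types, `u` sees the twins of `a` and the hats on
`bc` and `de`, and `a` sees the others. -/
theorem false_of_inducedC5 [Finite V] (hG : G.TriangleDominated)
    (hC : G.IsInducedC5 a b c d e) : False := by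
  obtain ⟨x, hx, hxm⟩ := hG.exists_minimal_twin hC
  obtain ⟨y, hy, hym⟩ := hG.exists_minimal_twin hC.reflect
  obtain ⟨u, hu, hux, huy⟩ := hG.exists_isHat_adj_adj hC hx hy.reflect
  obtain ⟨z, -, -, hza, hzu⟩ := hG.miss a u
  have hzu' : ¬ G.Adj u z := fun h => hzu h.symm
  rcases hG.isTwin_or_isHat hC z with (h | h | h | h | h) | h | h | h | h | h
  · exact hzu' (hG.hat_adj_twin hC h hu)
  · exact hza h.2.2.2.2
  · exact hzu' (hxm u hu hux z h)
  · exact hzu' (hym u hu.reflect huy z h.reflect)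
  · exact hza h.2.1
  · exact hza h.1
  · exact hzu (hG.hat_adj_hat hC.rotate h hu)
  · exact hza h.2.2.2.1
  · exact hzu' (hG.hat_adj_hat hC.rotate.rotate hu h)
  · exact hza h.2.1

theorem not_adj [Finite V] (hG : G.TriangleDominated) (a b : V) : ¬ G.Adj a b := fun h =>
  let ⟨_, _, _, _, _, hC⟩ := hG.exists_inducedC5 h
  hG.false_of_inducedC5 hC

end TriangleDominated
end SimpleGraph

/-! ### Minimum connected dominating sets of `P₅`-free graphs. -/

namespace SimpleGraph

theorem InducedFree.exists_chord {V : Type*} {G : SimpleGraph V} (h : (pathGraph 5).InducedFree G)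
    (a b c d e : V) (hab : G.Adj a b) (hbc : G.Adj b c) (hcd : G.Adj c d) (hde : G.Adj d e) :
    G.Adj a c ∨ G.Adj a d ∨ G.Adj a e ∨ G.Adj b d ∨ G.Adj b e ∨ G.Adj c e := by
  by_contra! hn
  obtain ⟨h1, h2, h3, h4, h5, h6⟩ := hn
  have n1 : a ≠ c := fun h => h2 (h ▸ hcd)
  have n2 : a ≠ d := fun h => h1 (h ▸ hcd.symm)
  have n3 : a ≠ e := fun h => h2 (h ▸ hde.symm)
  have n4 : b ≠ d := fun h => h5 (h ▸ hde)
  have n5 : b ≠ e := fun h => h4 (h ▸ hde.symm)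
  have n6 : c ≠ e := fun h => h5 (h ▸ hbc)
  have m1 := hab.ne
  have m2 := hbc.ne
  have m3 := hcd.ne
  have m4 := hde.ne
  have hadj : ∀ i j, G.Adj (![a, b, c, d, e] i) (![a, b, c, d, e] j) ↔ (pathGraph 5).Adj i j := by
    simp [Fin.forall_fin_succ, pathGraph_adj, *, hab.symm, hbc.symm, hcd.symm, hde.symm,
      mt (Adj.symm (G := G)) h1, mt (Adj.symm (G := G)) h2, mt (Adj.symm (G := G)) h3,
      mt (Adj.symm (G := G)) h4, mt (Adj.symm (G := G)) h5, mt (Adj.symm (G := G)) h6]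
  have hinj : ∀ i j, ![a, b, c, d, e] i = ![a, b, c, d, e] j → i = j := by
    simp [Fin.forall_fin_succ, *, n1.symm, n2.symm, n3.symm, n4.symm, n5.symm, n6.symm, m1.symm,
      m2.symm, m3.symm, m4.symm]
  exact h ⟨⟨⟨![a, b, c, d, e], fun {i j} => hinj i j⟩, fun {i j} => hadj i j⟩⟩

section ConnectedDominating

variable {V : Type*} [DecidableEq V]

/-- The subgraph of `G` induced by `D` is connected (or empty). -/
def ConnOn (G : SimpleGraph V) (D : Finset V) : Prop :=
  ∀ S ⊆ D, S.Nonempty → S ≠ D → ∃ a ∈ S, ∃ b ∈ D \ S, G.Adj a b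

/-- A connected dominating set of minimum cardinality. -/
structure IsMinCDS (G : SimpleGraph V) (D : Finset V) : Prop where
  conn : G.ConnOn D
  dom : ∀ v, v ∈ D ∨ ∃ u ∈ D, G.Adj u v
  min : ∀ D' : Finset V, D'.Nonempty → G.ConnOn D' → (∀ v, v ∈ D' ∨ ∃ u ∈ D', G.Adj u v) →
    D.card ≤ D'.card

variable {G : SimpleGraph V} {D : Finset V} {x y : V}

theorem connOn_of_star {c : V} (hc : c ∈ D) (h : ∀ u ∈ D, u ≠ c → G.Adj c u) : G.ConnOn D := by
  intro S hS ⟨s, hs⟩ hne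
  by_cases hcS : c ∈ S
  · obtain ⟨b, hb, hbS⟩ := Finset.exists_of_ssubset (hS.ssubset_of_ne hne)
    exact ⟨c, hcS, b, by simp [hb, hbS], h b hb (fun h => hbS (h ▸ hcS))⟩
  · exact ⟨s, hs, c, by simp [hc, hcS], (h s (hS hs) (fun h => hcS (h ▸ hs))).symm⟩

theorem ConnOn.insert {a b : V} (h : G.ConnOn D) (ha : a ∈ D) (hab : G.Adj a b) :
    G.ConnOn (insert b D) := by
  by_cases hb : b ∈ D
  · rwa [Finset.insert_eq_of_mem hb]
  intro S hS hne hne'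
  by_cases h1 : (S ∩ D).Nonempty
  · by_cases h2 : S ∩ D = D
    · have hDS : D ⊆ S := Finset.inter_eq_right.1 h2
      refine ⟨a, hDS ha, b, ?_, hab⟩
      simp only [Finset.mem_sdiff, Finset.mem_insert, true_or, true_and]
      exact fun hbS => hne' (hS.antisymm (Finset.insert_subset hbS hDS))
    · obtain ⟨p, hp, q, hq, hpq⟩ := h _ Finset.inter_subset_right h1 h2
      simp only [Finset.mem_inter, Finset.mem_sdiff, not_and] at hp hq
      exact ⟨p, hp.1, q, by simp [hq.1, show q ∉ S from fun h => hq.2 h hq.1], hpq⟩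
  · have h3 : ∀ s ∈ S, s = b := fun s hs => by
      rcases Finset.mem_insert.1 (hS hs) with h | h
      · exact h
      · exact absurd ⟨s, Finset.mem_inter.2 ⟨hs, h⟩⟩ h1
    obtain ⟨s, hs⟩ := hne
    refine ⟨b, h3 s hs ▸ hs, a, ?_, hab.symm⟩
    simp only [Finset.mem_sdiff, Finset.mem_insert, ha, or_true, true_and]
    exact fun h => hb (h3 a h ▸ ha)

/-- A connected proper subset of a connected set avoids some non-cut vertex. -/
theorem ConnOn.exists_erase (hD : G.ConnOn D) {A : Finset V} (hA : G.ConnOn A)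
    (hne : A.Nonempty) (hss : A ⊂ D) : ∃ b ∈ D, b ∉ A ∧ G.ConnOn (D.erase b) := by
  classical
  -- A largest connected proper subset of `D` containing `A` becomes all of `D` on adding any
  -- neighbour in `D`, so it misses one vertex.
  obtain ⟨C, hC, hmax⟩ := (D.powerset.filter fun C => A ⊆ C ∧ C ≠ D ∧ G.ConnOn C).exists_max_image
    Finset.card ⟨A, by simp [hss.subset, hss.ne, hA]⟩
  simp only [Finset.mem_filter, Finset.mem_powerset] at hC hmax
  obtain ⟨hCD, hAC, hCne, hCc⟩ := hC
  obtain ⟨a, ha, b, hb, hab⟩ := hD C hCD (hne.mono hAC) hCne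
  obtain ⟨hbD, hbC⟩ := Finset.mem_sdiff.1 hb
  refine ⟨b, hbD, fun h => hbC (hAC h), ?_⟩
  by_cases h : Insert.insert b C = D
  · rwa [← h, Finset.erase_insert hbC]
  · have := hmax (Insert.insert b C) ⟨Finset.insert_subset hbD hCD,
      hAC.trans (Finset.subset_insert _ _), h, hCc.insert ha hab⟩
    rw [Finset.card_insert_of_notMem hbC] at this
    omega

theorem ConnOn.exists_adj (h : G.ConnOn D) (hx : x ∈ D) (hne : (D.erase x).Nonempty) :
    ∃ z ∈ D.erase x, G.Adj x z := by
  obtain ⟨a, ha, b, hb, hab⟩ := h {x} (by simpa) (by simp) (by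
    rintro rfl
    simp at hne)
  simp only [Finset.mem_singleton, Finset.mem_sdiff] at ha hb
  subst ha
  exact ⟨b, by simp [hb], hab⟩

/-- `p` lies outside of `D` and `x` is its only neighbour in `D`. -/
def IsPrivate (G : SimpleGraph V) (D : Finset V) (x p : V) : Prop :=
  p ∉ D ∧ G.Adj x p ∧ ∀ u ∈ D, G.Adj u p → u = x

theorem IsMinCDS.exists_isPrivate (h : G.IsMinCDS D) (hx : x ∈ D)
    (hc : G.ConnOn (D.erase x)) (hne : (D.erase x).Nonempty) : ∃ p, G.IsPrivate D x p := by
  by_contra! hno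
  have := h.min (D.erase x) hne hc fun v => by
    by_contra! hv
    obtain ⟨hv1, hv2⟩ := hv
    by_cases hvx : v = x
    · subst hvx
      obtain ⟨z, hz, hvz⟩ := h.conn.exists_adj hx hne
      exact hv2 z hz hvz.symm
    have hvD : v ∉ D := fun h => hv1 (Finset.mem_erase.2 ⟨hvx, h⟩)
    have key : ∀ u ∈ D, G.Adj u v → u = x := fun u hu huv => by
      by_contra hux
      exact hv2 u (Finset.mem_erase.2 ⟨hux, hu⟩) huv
    obtain ⟨u, hu, huv⟩ := (h.dom v).resolve_left hvD
    exact hno v ⟨hvD, key u hu huv ▸ huv, key⟩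
  rw [Finset.card_erase_of_mem hx] at this
  have := Finset.card_pos.2 ⟨x, hx⟩
  omega

/-- Removing `y` leaves only `y` and its private neighbours undominated: `z` takes care of `y` and
`q` of the rest, at unchanged cardinality. -/
theorem IsMinCDS.swap (h : G.IsMinCDS D) (hy : y ∈ D) (hc : G.ConnOn (D.erase y)) {q s z : V}
    (hq : q ∉ D) (hs : s ∈ D.erase y) (hsq : G.Adj s q) (hz : z ∈ D.erase y) (hzy : G.Adj z y)
    (hp : ∀ p, G.IsPrivate D y p → G.Adj q p) : G.IsMinCDS (insert q (D.erase y)) where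
  conn := hc.insert hs hsq
  dom v := by
    by_cases hvy : v = y
    · exact Or.inr ⟨z, Finset.mem_insert_of_mem hz, hvy ▸ hzy⟩
    by_cases hvD : v ∈ D
    · exact Or.inl (by simp [hvy, hvD])
    right
    by_contra! hv
    have key : ∀ u ∈ D, G.Adj u v → u = y := fun u hu huv => by
      by_contra hux
      exact hv u (by simp [hux, hu]) huv
    obtain ⟨u, hu, huv⟩ := (h.dom v).resolve_left hvD
    exact hv q (by simp) (hp v ⟨hvD, key u hu huv ▸ huv, key⟩)
  min D' h1 h2 h3 := by
    rw [Finset.card_insert_of_notMem (fun h => hq (Finset.mem_of_mem_erase h)),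
      Finset.card_erase_of_mem hy]
    have := h.min D' h1 h2 h3
    have := Finset.card_pos.2 ⟨y, hy⟩
    omega


/-- Private neighbours prolong paths of `D`. Two exchanges, each replacing a vertex of `D` by a
private neighbour, grow a tail `x, x', x''`; a further vertex `z` with a private neighbour `z'` then
yields the induced path `z', z, x, x', x''`. -/
theorem IsMinCDS.card_le_three (h : G.IsMinCDS D)
    (hP : ∀ a b c d e, G.Adj a b → G.Adj b c → G.Adj c d → G.Adj d e →
      G.Adj a c ∨ G.Adj a d ∨ G.Adj a e ∨ G.Adj b d ∨ G.Adj b e ∨ G.Adj c e)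
    {u c : V} (hu : u ∈ D) (hc : c ∈ D) (huc : u ≠ c) (hnuc : ¬ G.Adj u c) : D.card ≤ 3 := by
  classical
  obtain ⟨x, hxD, hxA, hxc⟩ := h.conn.exists_erase (A := D.filter fun w => w = c ∨ G.Adj c w)
    (connOn_of_star (c := c) (by simp [hc]) (by simp; tauto)) ⟨c, by simp [hc]⟩
    ((Finset.filter_subset _ _).ssubset_of_ne fun h => by
      have := h ▸ hu
      simp only [Finset.mem_filter, hu, true_and] at this
      exact this.elim huc fun h => hnuc h.symm)
  simp only [Finset.mem_filter, hxD, true_and, not_or] at hxA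
  obtain ⟨y, hyD, hyA, hyc⟩ := h.conn.exists_erase (A := D.filter fun w => w = x ∨ G.Adj x w)
    (connOn_of_star (c := x) (by simp [hxD]) (by simp; tauto)) ⟨x, by simp [hxD]⟩
    ((Finset.filter_subset _ _).ssubset_of_ne fun h => by
      have := h ▸ hc
      simp only [Finset.mem_filter, hc, true_and] at this
      exact this.elim (Ne.symm hxA.1) fun h => hxA.2 h.symm)
  simp only [Finset.mem_filter, hyD, true_and, not_or] at hyA
  obtain ⟨hyx, hnxy⟩ := hyA
  obtain ⟨x', hx'⟩ := h.exists_isPrivate hxD hxc ⟨y, by simp [hyx, hyD]⟩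
  obtain ⟨hx'D, hxx', hx'u⟩ := hx'
  have hx'n : ∀ w ∈ D, w ≠ x → ¬ G.Adj w x' := fun w hw hwx h => hwx (hx'u w hw h)
  -- `y` is at distance two from `x` in `D`: a vertex of `D` at distance three would end an induced
  -- `P₅` starting at `x'`.
  obtain ⟨z, hzD, hxz, hzy⟩ : ∃ z ∈ D, G.Adj x z ∧ G.Adj z y := by
    by_contra! hno
    set S := D.filter fun w => (w = x ∨ G.Adj x w) ∨ ∃ z ∈ D, G.Adj x z ∧ G.Adj z w with hS
    have hyS : y ∉ S := by
      simp only [hS, Finset.mem_filter, hyD, true_and, hyx, hnxy, false_or, not_exists, not_and]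
      exact hno
    obtain ⟨a, ha, b, hb, hab⟩ := h.conn S (Finset.filter_subset _ _) ⟨x, by simp [hS, hxD]⟩
      fun h => hyS (h ▸ hyD)
    simp only [hS, Finset.mem_filter, Finset.mem_sdiff, not_and, not_or, not_exists] at ha hb
    obtain ⟨haD, ha⟩ := ha
    obtain ⟨hbD, hb⟩ := hb
    obtain ⟨⟨hb1, hb2⟩, hb3⟩ := hb hbD
    rcases ha with (rfl | ha) | ⟨z, hzD, hxz, hza⟩
    · exact hb2 hab
    · exact hb3 a haD ha hab
    · have hzb := hb3 z hzD hxz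
      have hax : a ≠ x := fun h => hb2 (h ▸ hab)
      have hxa : ¬ G.Adj x a := fun h => hb3 a haD h hab
      have e1 := hP x' x z a b hxx'.symm hxz hza hab
      have e2 := hx'n z hzD hxz.ne'
      have e3 := hx'n a haD hax
      have e4 := hx'n b hbD hb1
      simp only [G.adj_comm x', hxa, hb2, hzb, e2, e3, e4, or_self] at e1
  have hzy' : z ≠ y := hzy.ne
  have hDy : ∀ {w}, w ∈ D.erase y ↔ w ≠ y ∧ w ∈ D := Finset.mem_erase
  have hxy : x ∈ D.erase y := hDy.2 ⟨(Ne.symm hyx), hxD⟩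
  have h1 := h.swap hyD hyc hx'D hxy hxx' (hDy.2 ⟨hzy', hzD⟩) hzy fun p hp => by
    obtain ⟨-, hyp, hpu⟩ := hp
    have e1 := hP x' x z y p hxx'.symm hxz hzy hyp
    have e2 := hx'n z hzD hxz.ne'
    have e3 := hx'n y hyD hyx
    have e4 : ¬ G.Adj x p := fun h => hyx (hpu x hxD h).symm
    have e5 : ¬ G.Adj z p := fun h => hzy' (hpu z hzD h)
    simpa only [G.adj_comm x' z, G.adj_comm x' y, e2, e3, e4, e5, hnxy, or_false, false_or] using e1
  set D1 := insert x' (D.erase y) with hD1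
  have hx'D1 : x' ∉ D.erase y := fun h => hx'D (Finset.mem_of_mem_erase h)
  have hmem1 : ∀ {w}, w ∈ D.erase y → w ∈ D1 := fun h => Finset.mem_insert_of_mem h
  obtain ⟨x'', hx''D1, hx'', hx''u⟩ := h1.exists_isPrivate (x := x') (by simp [D1])
    (by rwa [hD1, Finset.erase_insert hx'D1]) (by
      rw [hD1, Finset.erase_insert hx'D1]
      exact ⟨x, hxy⟩)
  have hx''n : ∀ w ∈ D.erase y, ¬ G.Adj w x'' := fun w hw hwx =>
    hx'D1 (hx''u w (hmem1 hw) hwx ▸ hw)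
  -- After the first exchange `x` is a centre of `D.erase y`; otherwise `x'', x', x` extends to an
  -- induced `P₅`.
  have hxw : ∀ w ∈ D.erase y, w ≠ x → G.Adj x w := by
    by_contra! hno
    obtain ⟨w, hwD, hwx, hxw⟩ := hno
    set S := (D.erase y).filter fun w => w = x ∨ G.Adj x w with hS
    have hwS : w ∉ S := by simp [hS, hwx, hxw]
    obtain ⟨a, ha, b, hb, hab⟩ := hyc S (Finset.filter_subset _ _) ⟨x, by simp [hS, hxD, (Ne.symm hyx)]⟩
      fun h => hwS (h ▸ hwD)
    rw [Finset.mem_sdiff] at hb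
    obtain ⟨hbD, hbS⟩ := hb
    simp only [hS, Finset.mem_filter, hbD, true_and, not_or] at ha hbS
    obtain ⟨haD, rfl | hxa⟩ := ha
    · exact hbS.2 hab
    · have e1 := hP x'' x' x a b hx''.symm hxx'.symm hxa hab
      have e2 := hx''n x hxy
      have e3 := hx''n a haD
      have e4 := hx''n b hbD
      have e5 := hx'n a (hDy.1 haD).2 hxa.ne'
      have e6 := hx'n b (hDy.1 hbD).2 hbS.1
      simp only [G.adj_comm x'', G.adj_comm x', e2, e3, e4, e5, e6, hbS.2, or_self] at e1
  by_contra! hcard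
  obtain ⟨w, hw, z, hz, hwz⟩ := Finset.one_lt_card.1 (show 1 < ((D.erase y).erase x).card by
    rw [Finset.card_erase_of_mem hxy, Finset.card_erase_of_mem hyD]
    omega)
  rw [Finset.mem_erase] at hw hz
  obtain ⟨hwx, hwD⟩ := hw
  obtain ⟨hzx, hzD⟩ := hz
  have hw1 : w ∈ D1 := hmem1 hwD
  have hx1 : x ∈ D1 := hmem1 hxy
  have hstar : ∀ v ∈ D1, v ≠ x → G.Adj x v := by
    simp only [hD1, Finset.mem_insert]
    rintro v (rfl | hv) hvx
    · exact hxx'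
    · exact hxw v hv hvx
  have hx'w := hx'n w (hDy.1 hwD).2 hwx
  have hne' : ∀ v ∈ D.erase y, v ≠ x' := fun v hv h => hx'D1 (h ▸ hv)
  have h2 := h1.swap (y := w) (q := x'') (s := x') (z := x) hw1
    (connOn_of_star (c := x) (by simp [hx1, Ne.symm hwx]) fun v hv => hstar v
      (Finset.mem_of_mem_erase hv)) hx''D1 (by simp [hD1, (hne' w hwD).symm]) hx''
    (by simp [hx1, Ne.symm hwx]) (hxw w hwD hwx) fun p hp => by
      obtain ⟨-, hwp, hpu⟩ := hp
      have e1 := hP x'' x' x w p hx''.symm hxx'.symm (hxw w hwD hwx) hwp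
      have e2 := hx''n x hxy
      have e3 := hx''n w hwD
      have e4 : ¬ G.Adj x' p := fun h => hne' w hwD (hpu x' (by simp [hD1]) h).symm
      have e5 : ¬ G.Adj x p := fun h => hwx (hpu x hx1 h).symm
      simpa only [G.adj_comm x'' x, G.adj_comm x'' w, G.adj_comm x' w, e2, e3, e4, e5, hx'w,
        or_false, false_or] using e1
  have hx''z : z ≠ x'' := fun h => hx''D1 (h ▸ hmem1 hzD)
  have hx''w : w ≠ x'' := fun h => hx''D1 (h ▸ hw1)
  have hx''x : x ≠ x'' := fun h => hx''D1 (h ▸ hx1)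
  have hx''x' : x' ≠ x'' := hx''.ne
  obtain ⟨z', -, hzz', hz'u⟩ := h2.exists_isPrivate (x := z) (by simp [hwz.symm, hmem1 hzD]) (by
    rw [Finset.erase_insert_of_ne hx''z.symm]
    refine ConnOn.insert (a := x') (connOn_of_star (c := x) (by simp [hx1, Ne.symm hwx, hzx.symm])
      fun v hv => hstar v (Finset.mem_of_mem_erase (Finset.mem_of_mem_erase hv))) ?_ hx''
    simp [hD1, (hne' w hwD).symm, (hne' z hzD).symm]) ⟨x, by simp [hx1, Ne.symm hwx, hzx.symm]⟩
  have e1 := hP z' z x x' x'' hzz'.symm (hxw z hzD hzx).symm hxx' hx''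
  have e2 : ¬ G.Adj x z' := fun h => hzx (hz'u x (by simp [hx1, Ne.symm hwx]) h).symm
  have e3 : ¬ G.Adj x' z' := fun h => hne' z hzD
    (hz'u x' (by simp [hD1, (hne' w hwD).symm]) h).symm
  have e4 : ¬ G.Adj x'' z' := fun h => hx''z (hz'u x'' (by simp) h).symm
  have e5 := hx'n z (hDy.1 hzD).2 hzx
  have e6 := hx''n z hzD
  have e7 := hx''n x hxy
  simp only [G.adj_comm z', e2, e3, e4, e5, e6, e7, or_self] at e1

end ConnectedDominating
end SimpleGraph

/-! ### The bound on the domination number and the choice of `K` and `v`. -/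

namespace SimpleGraph

theorem dominationNumber_le {V : Type*} {G : SimpleGraph V} {S : Finset V} (h : G.Dominates S) :
    G.dominationNumber ≤ S.card :=
  Nat.sInf_le ⟨S, h, rfl⟩

theorem mem_closedNbhd {V : Type*} {G : SimpleGraph V} {u v : V} :
    v ∈ G.closedNbhd u ↔ v = u ∨ G.Adj u v := by
  simp [closedNbhd]

theorem exists_isGammaSet {V : Type*} [Fintype V] (G : SimpleGraph V) : ∃ D, G.IsGammaSet D :=
  Nat.sInf_mem (s := {n : ℕ | ∃ S : Finset V, G.Dominates S ∧ S.card = n})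
    ⟨_, Finset.univ, fun v => ⟨v, Finset.mem_univ v, mem_closedNbhd.2 (Or.inl rfl)⟩, rfl⟩

theorem power_le_dominationNumber {V : Type*} [Fintype V] (G : SimpleGraph V) :
    G.power ≤ G.dominationNumber := by
  classical
  obtain ⟨D, hD⟩ := G.exists_isGammaSet
  have h : G.power ≤ G.allegiance D := Nat.sInf_le ⟨D, hD, rfl⟩
  refine h.trans ?_
  rw [← hD.2]
  exact Finset.sup_le fun v _ => Finset.card_filter_le _ _

theorem Connected.exists_adj_of_mem_of_notMem {V : Type*} {G : SimpleGraph V} (hG : G.Connected)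
    {S : Set V} {a b : V} (ha : a ∈ S) (hb : b ∉ S) : ∃ x ∈ S, ∃ y ∉ S, G.Adj x y := by
  obtain ⟨p⟩ := hG.preconnected a b
  obtain ⟨d, -, h1, h2⟩ := p.exists_boundary_dart S ha hb
  exact ⟨_, h1, _, h2, d.adj⟩

theorem Connected.exists_isMinCDS {V : Type*} [Fintype V] [DecidableEq V] {G : SimpleGraph V}
    (hG : G.Connected) : ∃ D, G.IsMinCDS D := by
  classical
  have huniv : G.ConnOn Finset.univ := fun S _ ⟨a, ha⟩ hne => by
    obtain ⟨b, hb⟩ := not_forall.1 (fun h => hne (Finset.eq_univ_iff_forall.2 h))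
    obtain ⟨x, hx, y, hy, hxy⟩ := hG.exists_adj_of_mem_of_notMem (S := (S : Set V))
      (Finset.mem_coe.2 ha) (by simpa using hb)
    exact ⟨x, by simpa using hx, y, by simpa using hy, hxy⟩
  obtain ⟨D, hD, hmin⟩ := (Finset.univ.filter fun D : Finset V => D.Nonempty ∧ G.ConnOn D ∧
    ∀ v, v ∈ D ∨ ∃ u ∈ D, G.Adj u v).exists_min_image Finset.card
    ⟨Finset.univ, by simp [huniv, hG.nonempty]⟩
  simp only [Finset.mem_filter, Finset.mem_univ, true_and] at hD hmin
  exact ⟨D, hD.2.1, hD.2.2, fun D' h1 h2 h3 => hmin D' ⟨h1, h2, h3⟩⟩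

theorem InducedFree.cliqueFree {V : Type*} {G : SimpleGraph V} {r : ℕ}
    (h : (completeGraph (Fin r)).InducedFree G) : G.CliqueFree r := by
  by_contra hn
  exact h ⟨topEmbeddingOfNotCliqueFree hn⟩

theorem InducedFree.dominationNumber_le {V : Type*} [Fintype V] {G : SimpleGraph V}
    (hG : G.Connected) (hP5 : (pathGraph 5).InducedFree G) {r : ℕ} (hr : 4 ≤ r)
    (hK : (completeGraph (Fin r)).InducedFree G) : G.dominationNumber ≤ r - 1 := by
  classical
  obtain ⟨D, hD⟩ := hG.exists_isMinCDS
  have hdom : G.Dominates D := fun v => (hD.dom v).elim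
    (fun h => ⟨v, h, mem_closedNbhd.2 (Or.inl rfl)⟩)
    fun ⟨u, hu, huv⟩ => ⟨u, hu, mem_closedNbhd.2 (Or.inr huv)⟩
  refine (SimpleGraph.dominationNumber_le hdom).trans ?_
  by_cases hcl : G.IsClique (D : Set V)
  · by_contra! hlt
    exact hK.cliqueFree.mono (show r ≤ D.card by omega) D ⟨hcl, rfl⟩
  · simp only [IsClique, Set.Pairwise, not_forall] at hcl
    obtain ⟨u, hu, c, hc, huc, hn⟩ := hcl
    have := hD.card_le_three hP5.exists_chord hu hc huc hn
    omega

theorem InducedFree.not_adj {V : Type*} {G : SimpleGraph V}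
    (h : (completeGraph (Fin 4)).InducedFree G) (a b c d : V) (hab : G.Adj a b) (hac : G.Adj a c)
    (had : G.Adj a d) (hbc : G.Adj b c) (hbd : G.Adj b d) : ¬ G.Adj c d := by
  classical
  exact fun hcd => h.cliqueFree {a, b, c, d} ((is3Clique_triple_iff.2 ⟨hbc, hbd, hcd⟩).insert (by
    simp [hab, hac, had]))

/-- A maximal clique of a graph. -/
structure IsMaxClique {V : Type*} (G : SimpleGraph V) (K : Set V) : Prop where
  adj : ∀ ⦃x⦄, x ∈ K → ∀ ⦃y⦄, y ∈ K → x ≠ y → G.Adj x y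
  exists_not_adj : ∀ ⦃x⦄, x ∉ K → ∃ s ∈ K, ¬ G.Adj x s

/-- If all maximal cliques dominate, an edge in no triangle is a dominating pair, excluded by
`hmiss`, while triangles are maximal by `K₄`-freeness and so dominate. This is `TriangleDominated`,
which leaves no edge. -/
theorem exists_isMaxClique_anticomplete {V : Type*} [Finite V] {G : SimpleGraph V}
    (hG : G.Connected)
    (hP : ∀ a b c d e, G.Adj a b → G.Adj b c → G.Adj c d → G.Adj d e →
      G.Adj a c ∨ G.Adj a d ∨ G.Adj a e ∨ G.Adj b d ∨ G.Adj b e ∨ G.Adj c e)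
    (hK : ∀ a b c d, G.Adj a b → G.Adj a c → G.Adj a d → G.Adj b c → G.Adj b d → ¬ G.Adj c d)
    (hmiss : ∀ x y, ∃ z, z ≠ x ∧ z ≠ y ∧ ¬ G.Adj z x ∧ ¬ G.Adj z y) :
    ∃ K v, G.IsMaxClique K ∧ v ∉ K ∧ ∀ k ∈ K, ¬ G.Adj v k := by
  by_contra! hno
  have hT : G.TriangleDominated := by
    refine ⟨hP, hK, fun a b hab => ?_, fun a b c hab hac hbc v => ?_, hmiss⟩
    · by_contra! hn
      obtain ⟨z, hza, hzb, hna, hnb⟩ := hmiss a b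
      obtain ⟨k, hk, hzk⟩ := hno {a, b} z ⟨by
        rintro x (rfl | rfl) y (rfl | rfl) h
        exacts [absurd rfl h, hab, hab.symm, absurd rfl h], fun x _ => by
        by_cases hx : G.Adj a x
        · exact ⟨b, by simp, fun h => hn x hx h.symm⟩
        · exact ⟨a, by simp, fun h => hx h.symm⟩⟩ (by simp [hza, hzb])
      rcases hk with rfl | rfl
      exacts [hna hzk, hnb hzk]
    · by_contra! hv
      obtain ⟨ha, hb, hc⟩ := hv
      obtain ⟨k, hk, hzk⟩ := hno {a, b, c} v ⟨by
        rintro x (rfl | rfl | rfl) y (rfl | rfl | rfl) h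
        exacts [absurd rfl h, hab, hac, hab.symm, absurd rfl h, hbc, hac.symm, hbc.symm,
          absurd rfl h], fun x _ => by
        by_cases hxa : G.Adj x a
        · by_cases hxb : G.Adj x b
          · exact ⟨c, by simp, hK x a b c |> fun h h' => h hxa hxb h' hab hac hbc⟩
          · exact ⟨b, by simp, hxb⟩
        · exact ⟨a, by simp, hxa⟩⟩ (by
          rintro (rfl | rfl | rfl)
          exacts [hb hab, ha hab.symm, ha hac.symm])
      rcases hk with rfl | rfl | rfl
      exacts [ha hzk, hb hzk, hc hzk]
  obtain ⟨x⟩ := hG.nonempty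
  obtain ⟨z, hzx, -⟩ := hmiss x x
  obtain ⟨a, -, b, -, hab⟩ := hG.exists_adj_of_mem_of_notMem (S := {x}) rfl hzx
  exact hT.not_adj a b hab

end SimpleGraph

/-! ### A König argument for dominating two sets at once. -/

namespace SimpleGraph

section Koenig

variable {W : Type*} [DecidableEq W]

/-- A side of a vertex cover of minimum size of a bipartite relation can be matched into the
complement of the other side. -/
theorem exists_injective_of_minimal_cover {r : W → W → Prop} {L₁ L₂ C₁ C₂ : Finset W}
    (h₁ : C₁ ⊆ L₁) (h₂ : C₂ ⊆ L₂) (hC : ∀ a ∈ L₁, ∀ b ∈ L₂, r a b → a ∈ C₁ ∨ b ∈ C₂)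
    (hmin : ∀ D₁ ⊆ L₁, ∀ D₂ ⊆ L₂, (∀ a ∈ L₁, ∀ b ∈ L₂, r a b → a ∈ D₁ ∨ b ∈ D₂) →
      C₁.card + C₂.card ≤ D₁.card + D₂.card) :
    ∃ m : C₁ → W, Function.Injective m ∧ ∀ a, m a ∈ L₂ \ C₂ ∧ r a (m a) := by
  classical
  -- Hall's condition holds: replacing a violating set `s` in the cover by its neighbourhood would
  -- give a smaller cover.
  obtain ⟨m, hm, hm'⟩ := (Finset.all_card_le_biUnion_card_iff_exists_injective
    fun a : C₁ => (L₂ \ C₂).filter (r a)).1 fun s => by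
      set N := s.biUnion fun a : C₁ => (L₂ \ C₂).filter (r a) with hN
      have hNL : N ⊆ L₂ \ C₂ := Finset.biUnion_subset.2 fun a _ => Finset.filter_subset _ _
      have hs : s.map (Function.Embedding.subtype _) ⊆ C₁ := by
        intro a ha
        obtain ⟨b, -, rfl⟩ := Finset.mem_map.1 ha
        exact b.2
      have := hmin (C₁ \ s.map (Function.Embedding.subtype _))
        (Finset.sdiff_subset.trans h₁) (C₂ ∪ N)
        (Finset.union_subset h₂ (hNL.trans Finset.sdiff_subset)) fun a ha b hb hab => by
          by_cases hbC : b ∈ C₂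
          · exact Or.inr (Finset.mem_union_left _ hbC)
          have haC := (hC a ha b hb hab).resolve_right hbC
          by_cases has : (⟨a, haC⟩ : C₁) ∈ s
          · exact Or.inr (Finset.mem_union_right _ (Finset.mem_biUnion.2 ⟨_, has, by
              simp [hb, hbC, hab]⟩))
          · exact Or.inl (by simp [haC, has])
      have h3 := Finset.card_union_le C₂ N
      rw [Finset.card_sdiff_of_subset hs, Finset.card_map] at this
      have h4 := Finset.card_le_card hs
      rw [Finset.card_map] at h4
      omega
  exact ⟨m, hm, fun a => by simpa using hm' a⟩

/-- If every vertex of `E` has a neighbour in each of two disjoint subsets of `L`, then `L` and `E`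
can be dominated by `|L|` vertices in total. -/
theorem exists_dominating_pair (H : SimpleGraph W) {L L₁ L₂ : Finset W} {E : Set W}
    (h₁ : L₁ ⊆ L) (h₂ : L₂ ⊆ L) (hd : Disjoint L₁ L₂)
    (hE₁ : ∀ e ∈ E, ∃ a ∈ L₁, H.Adj e a) (hE₂ : ∀ e ∈ E, ∃ a ∈ L₂, H.Adj e a) :
    ∃ A C : Finset W, A.card + C.card ≤ L.card ∧ (∀ l ∈ L, l ∈ A ∨ ∃ a ∈ A, H.Adj a l) ∧
      ∀ e ∈ E, ∃ a ∈ C, H.Adj a e := by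
  classical
  -- Take a minimum cover `C₁ ∪ C₂` of this relation. It dominates `E`, and the common neighbours of
  -- the pairs matching it into its complement dominate twice as many vertices of `L` as their
  -- number. The rest of `L` dominates itself, so the total is at most `|L|`.
  let r : W → W → Prop := fun a b => ∃ e ∈ E, H.Adj e a ∧ H.Adj e b
  obtain ⟨⟨C₁, C₂⟩, hC, hmin⟩ := ((L₁.powerset ×ˢ L₂.powerset).filter
    fun C => ∀ a ∈ L₁, ∀ b ∈ L₂, r a b → a ∈ C.1 ∨ b ∈ C.2).exists_min_image
    (fun C => C.1.card + C.2.card) ⟨(L₁, L₂), by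
      simp only [Finset.mem_filter, Finset.mem_product, Finset.mem_powerset, subset_refl, true_and]
      exact fun a ha _ _ _ => Or.inl ha⟩
  simp only [Finset.mem_filter, Finset.mem_product, Finset.mem_powerset] at hC hmin
  obtain ⟨⟨hC₁, hC₂⟩, hC⟩ := hC
  obtain ⟨m₁, hm₁, hm₁'⟩ := exists_injective_of_minimal_cover (r := r) hC₁ hC₂ hC
    fun D₁ hD₁ D₂ hD₂ hD => hmin (D₁, D₂) ⟨⟨hD₁, hD₂⟩, hD⟩
  obtain ⟨m₂, hm₂, hm₂'⟩ := exists_injective_of_minimal_cover (r := fun a b => r b a) hC₂ hC₁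
    (fun a ha b hb hab => (hC b hb a ha hab).symm)
    fun D₁ hD₁ D₂ hD₂ hD => by
      have := hmin (D₂, D₁) ⟨⟨hD₂, hD₁⟩, fun a ha b hb hab => (hD b hb a ha hab).symm⟩
      simp only at this
      omega
  simp only [Finset.mem_sdiff] at hm₁' hm₂'
  choose e₁ he₁ using fun a => (hm₁' a).2
  choose e₂ he₂ using fun a => (hm₂' a).2
  set M₁ := Finset.univ.image m₁ with hM₁
  set M₂ := Finset.univ.image m₂ with hM₂
  have hcM₁ : M₁.card = C₁.card := by
    rw [hM₁, Finset.card_image_of_injective _ hm₁, Finset.card_univ, Fintype.card_coe]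
  have hcM₂ : M₂.card = C₂.card := by
    rw [hM₂, Finset.card_image_of_injective _ hm₂, Finset.card_univ, Fintype.card_coe]
  have hM₁L : ∀ b ∈ M₁, b ∈ L₂ ∧ b ∉ C₂ := by
    intro b hb
    obtain ⟨a, -, rfl⟩ := Finset.mem_image.1 hb
    exact (hm₁' a).1
  have hM₂L : ∀ b ∈ M₂, b ∈ L₁ ∧ b ∉ C₁ := by
    intro b hb
    obtain ⟨a, -, rfl⟩ := Finset.mem_image.1 hb
    exact (hm₂' a).1
  have hdis := Finset.disjoint_left.1 hd
  have hd1 : Disjoint C₁ M₂ := Finset.disjoint_left.2 fun a ha h => (hM₂L a h).2 ha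
  have hd2 : Disjoint C₂ M₁ := Finset.disjoint_left.2 fun a ha h => (hM₁L a h).2 ha
  have hd3 : Disjoint (C₁ ∪ M₂) (C₂ ∪ M₁) := hd.mono
    (Finset.union_subset hC₁ fun a h => (hM₂L a h).1)
    (Finset.union_subset hC₂ fun a h => (hM₁L a h).1)
  set M := (C₁ ∪ M₂) ∪ (C₂ ∪ M₁) with hM
  have hcM : M.card = 2 * (C₁.card + C₂.card) := by
    rw [hM, Finset.card_union_of_disjoint hd3, Finset.card_union_of_disjoint hd1,
      Finset.card_union_of_disjoint hd2, hcM₁, hcM₂]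
    ring
  have hML : M ⊆ L := Finset.union_subset
    (Finset.union_subset (hC₁.trans h₁) fun a h => h₁ (hM₂L a h).1)
    (Finset.union_subset (hC₂.trans h₂) fun a h => h₂ (hM₁L a h).1)
  refine ⟨(Finset.univ.image e₁ ∪ Finset.univ.image e₂) ∪ (L \ M), C₁ ∪ C₂, ?_, ?_, ?_⟩
  · have a1 := Finset.card_union_le (Finset.univ.image e₁ ∪ Finset.univ.image e₂) (L \ M)
    have a2 := Finset.card_union_le (Finset.univ.image e₁) (Finset.univ.image e₂)
    have a3 : (Finset.univ.image e₁).card ≤ C₁.card := Finset.card_image_le.trans (by simp)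
    have a4 : (Finset.univ.image e₂).card ≤ C₂.card := Finset.card_image_le.trans (by simp)
    have a5 := Finset.card_union_le C₁ C₂
    have a6 := Finset.card_sdiff_of_subset hML
    have a7 := Finset.card_le_card hML
    omega
  · intro l hl
    by_cases hlM : l ∈ M
    · right
      simp only [hM, Finset.mem_union] at hlM
      have k1 : ∀ a, e₁ a ∈ (Finset.univ.image e₁ ∪ Finset.univ.image e₂) ∪ (L \ M) := fun a =>
        Finset.mem_union_left _ (Finset.mem_union_left _
          (Finset.mem_image_of_mem _ (Finset.mem_univ a)))
      have k2 : ∀ a, e₂ a ∈ (Finset.univ.image e₁ ∪ Finset.univ.image e₂) ∪ (L \ M) := fun a =>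
        Finset.mem_union_left _ (Finset.mem_union_right _
          (Finset.mem_image_of_mem _ (Finset.mem_univ a)))
      rcases hlM with (h | h) | (h | h)
      · exact ⟨_, k1 ⟨l, h⟩, (he₁ ⟨l, h⟩).2.1⟩
      · obtain ⟨a, -, rfl⟩ := Finset.mem_image.1 h
        exact ⟨_, k2 a, (he₂ a).2.1⟩
      · exact ⟨_, k2 ⟨l, h⟩, (he₂ ⟨l, h⟩).2.2⟩
      · obtain ⟨a, -, rfl⟩ := Finset.mem_image.1 h
        exact ⟨_, k1 a, (he₁ a).2.2⟩
    · exact Or.inl (Finset.mem_union_right _ (Finset.mem_sdiff.2 ⟨hl, hlM⟩))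
  · intro e he
    obtain ⟨a, ha, hea⟩ := hE₁ e he
    obtain ⟨b, hb, heb⟩ := hE₂ e he
    rcases hC a ha b hb ⟨e, he, hea, heb⟩ with h | h
    · exact ⟨a, Finset.mem_union_left _ h, hea.symm⟩
    · exact ⟨b, Finset.mem_union_right _ h, heb.symm⟩

end Koenig
end SimpleGraph

/-! ### Fibres and tokens; domination number at most two. -/

namespace SimpleGraph

section Vizing

variable {V W : Type*} {G : SimpleGraph V} {H : SimpleGraph W}

/-- The set of pairs `(g, h)` with `g ∈ f h` dominates the Cartesian product. -/
def FibrewiseDominates (G : SimpleGraph V) (H : SimpleGraph W) (f : W → Finset V) : Prop :=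
  ∀ h g, g ∈ f h ∨ (∃ x ∈ f h, G.Adj x g) ∨ ∃ h', H.Adj h' h ∧ g ∈ f h'

theorem Dominates.fibrewiseDominates [Fintype V] [DecidableEq V] [DecidableEq W]
    {D : Finset (V × W)} (hD : (G.boxProd H).Dominates D) :
    G.FibrewiseDominates H fun h => Finset.univ.filter fun g => (g, h) ∈ D := by
  intro h g
  obtain ⟨⟨x, y⟩, hxy, hu⟩ := hD (g, h)
  rw [mem_closedNbhd, boxProd_adj] at hu
  simp only [Prod.mk.injEq, Finset.mem_filter, Finset.mem_univ, true_and] at hu ⊢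
  rcases hu with ⟨rfl, rfl⟩ | ⟨h1, rfl⟩ | ⟨h1, rfl⟩
  · exact Or.inl hxy
  · exact Or.inr (Or.inl ⟨x, hxy, h1⟩)
  · exact Or.inr (Or.inr ⟨y, h1, hxy⟩)

theorem sum_card_fibre [Fintype V] [Fintype W] [DecidableEq V] [DecidableEq W]
    (D : Finset (V × W)) : ∑ h, (Finset.univ.filter fun g => (g, h) ∈ D).card = D.card := by
  rw [Finset.card_eq_sum_card_fiberwise (f := Prod.snd) (t := Finset.univ) (by simp)]
  refine Finset.sum_congr rfl fun h _ => Finset.card_bij (fun g _ => (g, h)) ?_ ?_ ?_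
  · simp
  · simp
  · rintro ⟨g, h'⟩
    simp only [Finset.mem_filter, Finset.mem_univ, true_and]
    rintro ⟨h1, rfl⟩
    exact ⟨g, h1, rfl⟩

theorem dominationNumber_le_card {T : Finset W} (hT : ∀ h, h ∈ T ∨ ∃ h' ∈ T, H.Adj h' h) :
    H.dominationNumber ≤ T.card :=
  dominationNumber_le fun v => (hT v).elim (fun h => ⟨v, h, mem_closedNbhd.2 (Or.inl rfl)⟩)
    fun ⟨u, hu, huv⟩ => ⟨u, hu, mem_closedNbhd.2 (Or.inr huv)⟩

theorem sum_card_tokens [Fintype W] {k : ℕ} (c : W → Finset (Fin k)) :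
    ∑ i, (Finset.univ.filter fun h => i ∈ c h).card = ∑ h, (c h).card := by
  simp only [Finset.card_filter]
  rw [Finset.sum_comm]
  simp

/-- If `k` colours are distributed such that each colour class dominates, then the number of
colours used, with multiplicity, is at least `k` times the domination number. -/
theorem mul_dominationNumber_le_sum_card [Fintype W] {k : ℕ} (c : W → Finset (Fin k))
    (hc : ∀ i h, i ∈ c h ∨ ∃ h', H.Adj h' h ∧ i ∈ c h') :
    k * H.dominationNumber ≤ ∑ h, (c h).card := by
  rw [← sum_card_tokens]
  refine le_trans (by simp) (Finset.card_nsmul_le_sum Finset.univ _ H.dominationNumber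
    fun i _ => dominationNumber_le_card fun h => ?_)
  rcases hc i h with h1 | ⟨h', h1, h2⟩
  · exact Or.inl (by simpa)
  · exact Or.inr ⟨h', by simpa, h1⟩

theorem FibrewiseDominates.dominationNumber_le_sum [Fintype W] [Nonempty V] {f : W → Finset V}
    (hf : G.FibrewiseDominates H f) : H.dominationNumber ≤ ∑ h, (f h).card := by
  classical
  have g := Classical.arbitrary V
  refine (dominationNumber_le_card (T := Finset.univ.filter fun h => (f h).Nonempty)
    fun h => ?_).trans ?_
  · simp only [Finset.mem_filter, Finset.mem_univ, true_and]
    rcases hf h g with h1 | ⟨x, h1, -⟩ | ⟨h', h1, h2⟩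
    exacts [Or.inl ⟨_, h1⟩, Or.inl ⟨_, h1⟩, Or.inr ⟨h', ⟨_, h2⟩, h1⟩]
  · rw [Finset.card_filter]
    refine Finset.sum_le_sum fun h _ => ?_
    split_ifs with h1
    exacts [Finset.card_pos.2 h1, Nat.zero_le _]

theorem exists_isMaxClique [Finite V] (G : SimpleGraph V) : ∃ K, G.IsMaxClique K := by
  obtain ⟨K, hK⟩ := (Set.toFinite {K : Set V | G.IsClique K}).exists_maximal
    ⟨∅, Set.pairwise_empty _⟩
  refine ⟨K, hK.1, fun x hx => ?_⟩
  by_contra! h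
  exact hx (hK.2 (y := insert x K) (hK.1.insert fun y hy _ => h y hy) (Set.subset_insert x K)
    (Set.mem_insert x K))

theorem FibrewiseDominates.two_mul_dominationNumber_le_sum [Fintype W] [Finite V]
    {f : W → Finset V} (hf : G.FibrewiseDominates H f)
    (hmiss : ∀ x, ∃ z, z ≠ x ∧ ¬ G.Adj x z) [Nonempty V] :
    2 * H.dominationNumber ≤ ∑ h, (f h).card := by
  classical
  obtain ⟨K, hK⟩ := G.exists_isMaxClique
  -- Every vertex outside a class misses some vertex of it: by maximality for `K`, and for `Kᶜ`
  -- because a vertex missed by a member of `K` lies outside `K`. So a one-vertex fibre can afford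
  -- just the token of its own class.
  let A : Fin 2 → Set V := ![K, Kᶜ]
  have hA : ∀ i x, x ∉ A i → ∃ z ∈ A i, z ≠ x ∧ ¬ G.Adj x z := by
    intro i x hx
    fin_cases i
    · obtain ⟨s, hs, hxs⟩ := hK.exists_not_adj hx
      exact ⟨s, hs, fun h => hx (h ▸ hs), hxs⟩
    · obtain ⟨z, hzx, hxz⟩ := hmiss x
      exact ⟨z, fun hz => hxz (hK.adj (not_not.1 hx) hz hzx.symm), hzx, hxz⟩
  have hA' : ∀ i, (A i).Nonempty := by
    intro i
    by_cases h : Classical.arbitrary V ∈ A i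
    · exact ⟨_, h⟩
    · obtain ⟨z, hz, -⟩ := hA i _ h
      exact ⟨z, hz⟩
  let c : W → Finset (Fin 2) := fun h => Finset.univ.filter fun i =>
    (∃ x ∈ f h, x ∈ A i) ∨ 2 ≤ (f h).card
  have hc : ∀ {i h}, i ∈ c h ↔ (∃ x ∈ f h, x ∈ A i) ∨ 2 ≤ (f h).card := by simp [c]
  refine (mul_dominationNumber_le_sum_card (H := H) c fun i h => ?_).trans
    (Finset.sum_le_sum fun h _ => ?_)
  · by_contra! hn
    obtain ⟨h1, h2⟩ := hn
    have h1' : ∀ x ∈ f h, x ∉ A i := fun x hx hxi =>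
      h1 (hc.2 (Or.inl ⟨x, hx, hxi⟩))
    have h1'' : (f h).card ≤ 1 := by
      by_contra! h3
      exact h1 (hc.2 (Or.inr h3))
    obtain ⟨z, hzi, hz⟩ : ∃ z ∈ A i, z ∉ f h ∧ ∀ x ∈ f h, ¬ G.Adj x z := by
      rcases (f h).eq_empty_or_nonempty with he | ⟨x, hx⟩
      · obtain ⟨z, hz⟩ := hA' i
        exact ⟨z, hz, by simp [he]⟩
      · obtain ⟨z, hz, hzx, hxz⟩ := hA i x (h1' x hx)
        have key : ∀ y ∈ f h, y = x := fun y hy => Finset.card_le_one.1 h1'' y hy x hx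
        exact ⟨z, hz, fun h => hzx (key z h), fun y hy => key y hy ▸ hxz⟩
    rcases hf h z with h3 | ⟨x, h3, h4⟩ | ⟨h', h3, h4⟩
    · exact hz.1 h3
    · exact hz.2 x h3 h4
    · exact h2 h' h3 (hc.2 (Or.inl ⟨z, h4, hzi⟩))
  · by_cases h2 : 2 ≤ (f h).card
    · exact (Finset.card_le_univ _).trans (by simpa)
    rcases (f h).eq_empty_or_nonempty with he | ⟨x, hx⟩
    · simp [c, he]
    · have key : ∀ y ∈ f h, y = x := fun y hy => Finset.card_le_one.1 (by omega) y hy x hx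
      refine le_trans (Finset.card_le_one.2 ?_) (Finset.card_pos.2 ⟨x, hx⟩)
      have h01 : ∀ i ∈ c h, x ∈ A i := by
        intro i hi
        obtain ⟨y, hy, hyi⟩ := (hc.1 hi).resolve_right h2
        exact key y hy ▸ hyi
      intro i hi j hj
      have hi' := h01 i hi
      have hj' := h01 j hj
      fin_cases i <;> fin_cases j
      exacts [rfl, absurd hi' hj', absurd hj' hi', rfl]

end Vizing
end SimpleGraph

/-! ### Three tokens on a single fibre. -/

namespace SimpleGraph

section ThreeTokens

variable {V W : Type*} {G : SimpleGraph V} {H : SimpleGraph W} {K : Set V} {v : V}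
  {f : Finset V}

/-- `g` is dominated by `f`. -/
def Covers (G : SimpleGraph V) (f : Finset V) (g : V) : Prop :=
  g ∈ f ∨ ∃ x ∈ f, G.Adj x g

/-- A maximal clique `K` and a vertex `v` without neighbours in `K`, in a graph in which no two
vertices dominate. -/
structure IsAnchor (G : SimpleGraph V) (K : Set V) (v : V) : Prop where
  clique : G.IsMaxClique K
  notMem : v ∉ K
  not_adj : ∀ k ∈ K, ¬ G.Adj v k
  miss : ∀ x y, ∃ z, z ≠ x ∧ z ≠ y ∧ ¬ G.Adj z x ∧ ¬ G.Adj z y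

/-- The vertices outside of `K` that are neither `v` nor adjacent to `v`. -/
def far (G : SimpleGraph V) (K : Set V) (v : V) : Set V :=
  {s | s ≠ v ∧ ¬ G.Adj v s ∧ s ∉ K}

/-- Tokens `0`, `1`, `2` stand for `v`, `K` and `far G K v`. A vertex of `f` brings the token of its
class, and a missing token is witnessed by an undominated vertex of the class. -/
structure IsTokenSet (G : SimpleGraph V) (K : Set V) (v : V) (f : Finset V)
    (c : Finset (Fin 3)) : Prop where
  zero_mem : v ∈ f → 0 ∈ c
  one_mem : ∀ k ∈ K, k ∈ f → 1 ∈ c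
  two_mem : ∀ s ∈ G.far K v, s ∈ f → 2 ∈ c
  zero_cov : 0 ∉ c → ¬ G.Covers f v
  one_cov : 1 ∉ c → ∃ k ∈ K, ¬ G.Covers f k
  two_cov : 2 ∉ c → ∃ s ∈ G.far K v, ¬ G.Covers f s
  card_le : c.card ≤ f.card

/-- `f` contains a neighbour of `v`, but `0` lies in no token set of `f`. -/
def IsPoor (G : SimpleGraph V) (K : Set V) (v : V) (f : Finset V) : Prop :=
  (∃ x ∈ f, G.Adj v x) ∧ ∀ c, G.IsTokenSet K v f c → 0 ∉ c

theorem mem_or_adj_or_mem_far (x : V) : x = v ∨ G.Adj v x ∨ x ∈ K ∨ x ∈ G.far K v := by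
  unfold far
  simp only [Set.mem_ofPred_eq]
  tauto

theorem not_covers_pair [DecidableEq V] {x y g : V} :
    ¬ G.Covers {x, y} g ↔ (g ≠ x ∧ g ≠ y) ∧ ¬ G.Adj x g ∧ ¬ G.Adj y g := by
  simp [Covers]

theorem not_covers_singleton {x g : V} :
    ¬ G.Covers {x} g ↔ g ≠ x ∧ ¬ G.Adj x g := by
  simp [Covers]

namespace IsAnchor

theorem exists_far (h : G.IsAnchor K v) {y : V} (hy : y ∈ K) :
    ∃ t ∈ G.far K v, t ≠ y ∧ ¬ G.Adj y t := by
  obtain ⟨t, h1, h2, h3, h4⟩ := h.miss v y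
  exact ⟨t, ⟨h1, fun h => h3 h.symm, fun htK => h4 (h.clique.adj htK hy h2)⟩, h2,
    fun h => h4 h.symm⟩

theorem exists_mem (h : G.IsAnchor K v) {x : V} (hx : x ∉ K) :
    ∃ k ∈ K, k ≠ x ∧ ¬ G.Adj x k := by
  obtain ⟨k, hk, hxk⟩ := h.clique.exists_not_adj hx
  exact ⟨k, hk, fun h => hx (h ▸ hk), hxk⟩

theorem isTokenSet_univ (hf : 3 ≤ f.card) : G.IsTokenSet K v f Finset.univ :=
  ⟨by simp, by simp, by simp, by simp, by simp, by simp, by simpa⟩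

theorem isTokenSet_insert_self [DecidableEq V] (h : G.IsAnchor K v) {x : V} (hxv : x ≠ v)
    (hx : x ∉ K) : G.IsTokenSet K v {v, x} {0, 2} where
  zero_mem _ := by simp
  one_mem k hk hkf := by
    rcases Finset.mem_insert.1 hkf with rfl | hkx
    · exact absurd hk h.notMem
    · exact absurd (Finset.mem_singleton.1 hkx ▸ hk) hx
  two_mem _ _ _ := by simp
  zero_cov h0 := by simp at h0
  one_cov _ := by
    obtain ⟨k, hk, hkx, hxk⟩ := h.exists_mem hx
    exact ⟨k, hk, not_covers_pair.2 ⟨⟨fun e => h.notMem (e ▸ hk), hkx⟩, h.not_adj k hk, hxk⟩⟩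
  two_cov h2 := by simp at h2
  card_le := by simp [Finset.card_pair hxv.symm]

theorem isTokenSet_insert_self' [DecidableEq V] (h : G.IsAnchor K v) {x : V} (hx : x ∈ K) :
    G.IsTokenSet K v {v, x} {0, 1} where
  zero_mem _ := by simp
  one_mem _ _ _ := by simp
  two_mem s hs hsf := by
    rcases Finset.mem_insert.1 hsf with rfl | hkx
    · exact absurd rfl hs.1
    · exact absurd (Finset.mem_singleton.1 hkx ▸ hx) hs.2.2
  zero_cov h0 := by simp at h0
  one_cov h1 := by simp at h1
  two_cov _ := by
    obtain ⟨s, hs, hsx, hxs⟩ := h.exists_far hx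
    exact ⟨s, hs, not_covers_pair.2 ⟨⟨hs.1, hsx⟩, hs.2.1, hxs⟩⟩
  card_le := by
    have hvx : v ≠ x := fun e => h.notMem (by rw [e]; exact hx)
    simp [Finset.card_pair hvx]

theorem isTokenSet_pair [DecidableEq V] {x y : V} (hxy : x ≠ y)
    (hx : x ≠ v) (hy : y ≠ v) (hvx : ¬ G.Adj v x) (hvy : ¬ G.Adj v y) :
    G.IsTokenSet K v {x, y} {1, 2} where
  zero_mem hv := by
    simp only [Finset.mem_insert, Finset.mem_singleton] at hv
    exact (hv.elim hx.symm hy.symm).elim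
  one_mem _ _ _ := by simp
  two_mem _ _ _ := by simp
  zero_cov _ := not_covers_pair.2 ⟨⟨hx.symm, hy.symm⟩, fun e => hvx e.symm, fun e => hvy e.symm⟩
  one_cov h1 := by simp at h1
  two_cov h2 := by simp at h2
  card_le := by simp [Finset.card_pair hxy]

theorem isTokenSet_empty (h : G.IsAnchor K v) : G.IsTokenSet K v ∅ ∅ := by
  obtain ⟨k, hk, -⟩ := h.exists_mem h.notMem
  obtain ⟨s, hs, -⟩ := h.exists_far hk
  exact ⟨by simp, by simp, by simp, by simp [Covers], fun _ => ⟨k, hk, by simp [Covers]⟩,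
    fun _ => ⟨s, hs, by simp [Covers]⟩, by simp⟩

theorem exists_isTokenSet_singleton (h : G.IsAnchor K v) {x : V} (hx : ¬ G.Adj v x) :
    ∃ c, G.IsTokenSet K v {x} c := by
  obtain ⟨k, hk, hkv, hvk⟩ := h.exists_mem h.notMem
  obtain ⟨s, hs, hsk, hks⟩ := h.exists_far hk
  rcases mem_or_adj_or_mem_far (G := G) (K := K) (v := v) x with rfl | hvx | hxK | hxs
  · refine ⟨{0}, by simp, fun k hk hkx => ?_, fun s hs hsx => ?_, by simp,
      fun _ => ⟨k, hk, not_covers_singleton.2 ⟨hkv, hvk⟩⟩,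
      fun _ => ⟨s, hs, not_covers_singleton.2 ⟨hs.1, hs.2.1⟩⟩, by simp⟩
    · exact absurd (Finset.mem_singleton.1 hkx ▸ hk) h.notMem
    · exact absurd (Finset.mem_singleton.1 hsx) hs.1
  · exact absurd hvx hx
  · have hxv : v ≠ x := fun e => h.notMem (by rw [e]; exact hxK)
    obtain ⟨s, hs, hsx, hxs⟩ := h.exists_far hxK
    exact ⟨{1}, fun e => absurd (Finset.mem_singleton.1 e) hxv, by simp,
      fun s hs hsx => absurd (Finset.mem_singleton.1 hsx ▸ hxK) hs.2.2,
      fun _ => not_covers_singleton.2 ⟨hxv, fun e => hx e.symm⟩, by simp,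
      fun _ => ⟨s, hs, not_covers_singleton.2 ⟨hsx, hxs⟩⟩, by simp⟩
  · obtain ⟨k, hk, hkx, hxk⟩ := h.exists_mem hxs.2.2
    exact ⟨{2}, fun e => absurd (Finset.mem_singleton.1 e).symm hxs.1,
      fun k hk hkx => absurd (Finset.mem_singleton.1 hkx ▸ hk) hxs.2.2, by simp,
      fun _ => not_covers_singleton.2 ⟨hxs.1.symm, fun e => hx e.symm⟩,
      fun _ => ⟨k, hk, not_covers_singleton.2 ⟨hkx, hxk⟩⟩, by simp, by simp⟩

/-- Vertices other than neighbours of `v` have a class. One vertex brings its own token; two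
vertices different from `v` can take tokens `1` and `2`, as they leave `v` undominated. -/
theorem exists_isTokenSet (h : G.IsAnchor K v) (hf : ∀ x ∈ f, ¬ G.Adj v x) :
    ∃ c, G.IsTokenSet K v f c := by
  classical
  have hins : ∀ {x}, x ≠ v → ∃ c, G.IsTokenSet K v {v, x} c := fun {x} hx => by
    by_cases hxK : x ∈ K
    exacts [⟨_, h.isTokenSet_insert_self' hxK⟩, ⟨_, h.isTokenSet_insert_self hx hxK⟩]
  have hcard : f.card = 0 ∨ f.card = 1 ∨ f.card = 2 ∨ 3 ≤ f.card := by omega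
  rcases hcard with h0 | h1 | h2 | h3
  · rw [Finset.card_eq_zero] at h0
    exact h0 ▸ ⟨_, h.isTokenSet_empty⟩
  · obtain ⟨x, rfl⟩ := Finset.card_eq_one.1 h1
    exact h.exists_isTokenSet_singleton (hf x (by simp))
  · obtain ⟨x, y, hxy, rfl⟩ := Finset.card_eq_two.1 h2
    by_cases hx : x = v
    · subst hx
      exact hins hxy.symm
    by_cases hy : y = v
    · subst hy
      rw [Finset.pair_comm]
      exact hins hx
    · exact ⟨_, isTokenSet_pair hxy hx hy (hf x (by simp)) (hf y (by simp))⟩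
  · exact ⟨_, isTokenSet_univ h3⟩

/-- The shape of a poor set. -/
theorem isPoor_cases [DecidableEq V] (h : G.IsAnchor K v) (hf : G.IsPoor K v f) :
    (∃ x, G.Adj v x ∧ f = {x}) ∨ ∃ x y, G.Adj v x ∧ x ≠ y ∧ y ≠ v ∧ f = {x, y} ∧
      (∀ k ∈ K, G.Covers f k) ∧ (y ∈ G.far K v ∨ y ∉ G.far K v ∧ ∀ s ∈ G.far K v, G.Covers f s) := by
  obtain ⟨⟨x, hxf, hvx⟩, hc⟩ := hf
  have hxK : x ∉ K := fun hx => h.not_adj x hx hvx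
  have hxS : x ∉ G.far K v := fun hx => hx.2.1 hvx
  have hpos : 0 < f.card := Finset.card_pos.2 ⟨x, hxf⟩
  have hcard : f.card = 1 ∨ f.card = 2 ∨ 3 ≤ f.card := by omega
  rcases hcard with h1 | h2 | h3
  · obtain ⟨z, rfl⟩ := Finset.card_eq_one.1 h1
    rw [Finset.mem_singleton.1 hxf] at hvx
    exact Or.inl ⟨z, hvx, rfl⟩
  · obtain ⟨y, hxy, rfl⟩ : ∃ y, x ≠ y ∧ f = {x, y} := by
      obtain ⟨a, b, hab, rfl⟩ := Finset.card_eq_two.1 h2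
      rcases Finset.mem_insert.1 hxf with rfl | hxb
      · exact ⟨b, hab, rfl⟩
      · rw [Finset.mem_singleton] at hxb
        subst hxb
        exact ⟨a, hab.symm, Finset.pair_comm _ _⟩
    have hyv : y ≠ v := by
      rintro rfl
      have := hc {0, 2} (by
        rw [Finset.pair_comm]
        exact h.isTokenSet_insert_self hxy hxK)
      simp at this
    have hmem : ∀ {g}, g ∈ ({x, y} : Finset V) → g = x ∨ g = y := fun hg => by simpa using hg
    have hvf : v ∉ ({x, y} : Finset V) := fun e => (hmem e).elim hvx.ne hyv.symm
    right
    refine ⟨x, y, hvx, hxy, hyv, rfl, ?_, ?_⟩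
    · by_contra! hn
      obtain ⟨k, hk, hkn⟩ := hn
      have hyK : y ∉ K := fun hy => (not_covers_pair.1 hkn).2.2
        (h.clique.adj hy hk (not_covers_pair.1 hkn).1.2.symm)
      have := hc {0, 2} ⟨fun e => absurd e hvf, fun k hk e => ?_, by simp, by simp,
        fun _ => ⟨k, hk, hkn⟩, by simp, by simp [Finset.card_pair hxy]⟩
      · simp at this
      · rcases hmem e with rfl | rfl
        exacts [absurd hk hxK, absurd hk hyK]
    · by_contra! hn
      obtain ⟨hyS, hn⟩ := hn
      obtain ⟨s, hs, hsn⟩ := hn hyS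
      have := hc {0, 1} ⟨fun e => absurd e hvf, by simp, fun s hs e => ?_, by simp, by simp,
        fun _ => ⟨s, hs, hsn⟩, by simp [Finset.card_pair hxy]⟩
      · simp at this
      · rcases hmem e with rfl | rfl
        exacts [absurd hs hxS, absurd hs hyS]
  · exact absurd (Finset.mem_univ 0) (hc _ (isTokenSet_univ h3))

end IsAnchor

end ThreeTokens
end SimpleGraph

/-! ### Distributing three tokens over all fibres, and counting. -/

namespace SimpleGraph

section Assignment

variable {V W : Type*} {G : SimpleGraph V} {H : SimpleGraph W} {K : Set V} {v : V}
  {f : W → Finset V}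

theorem exists_maximal_independent [Finite W] (H : SimpleGraph W) {I X : Set W} (hIX : I ⊆ X)
    (hI : ∀ a ∈ I, ∀ b ∈ I, ¬ H.Adj a b) : ∃ O, I ⊆ O ∧ O ⊆ X ∧ (∀ a ∈ O, ∀ b ∈ O, ¬ H.Adj a b) ∧
      ∀ x ∈ X, x ∉ O → ∃ o ∈ O, H.Adj o x := by
  obtain ⟨O, hO, hmax⟩ := (Set.toFinite {O : Set W | O ⊆ X ∧ ∀ a ∈ O, ∀ b ∈ O,
    ¬ H.Adj a b}).exists_le_maximal ⟨hIX, hI⟩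
  refine ⟨O, hO, hmax.1.1, hmax.1.2, fun x hx hxO => ?_⟩
  by_contra! hn
  refine hxO (hmax.2 (y := insert x O) ⟨Set.insert_subset hx hmax.1.1, ?_⟩ (Set.subset_insert x O)
    (Set.mem_insert x O))
  rintro a (rfl | ha) b (rfl | hb)
  exacts [H.irrefl, fun h => hn b hb h.symm, hn a ha, hmax.1.2 a ha b hb]

namespace IsAnchor

/-- Token `0` dominates everywhere, token `1` off `L`, and token `2` except where `L` supplies every
far vertex. Fibres over `L` keep a spare token to repair these defects. -/
theorem exists_token_assignment [Finite W] (h : G.IsAnchor K v)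
    (hf : G.FibrewiseDominates H f) : ∃ (c : W → Finset (Fin 3)) (L : Set W),
      (∀ w, (c w).card ≤ (f w).card) ∧ (∀ w ∈ L, (c w).card + 1 ≤ (f w).card) ∧
      (∀ w, 0 ∈ c w ∨ ∃ w', H.Adj w' w ∧ 0 ∈ c w') ∧
      (∀ w ∉ L, 1 ∈ c w ∨ ∃ w', H.Adj w' w ∧ 1 ∈ c w') ∧
      (∀ w, (2 ∈ c w ∨ ∃ w', H.Adj w' w ∧ 2 ∈ c w') ∨
        ∀ s ∈ G.far K v, ∃ l ∈ L, H.Adj w l ∧ s ∈ f l) ∧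
      ∀ l ∈ L, (∀ s ∈ G.far K v, ∀ t ∈ G.far K v, s ∈ f l → t ∈ f l → s = t) ∧
        ∃ s ∈ G.far K v, s ∉ f l := by
  classical
  set P : Set W := {w | G.IsPoor K v (f w)} with hP
  set B : Set W := {w | ∃ s ∈ G.far K v, s ∈ f w} with hB
  set Q : Set W := {w | w ∈ P ∧ ∃ w' ∈ P, H.Adj w' w} with hQ
  -- Poor fibres over `O` give up token `0`, which they get from poor neighbours outside `O`.
  -- Starting from `J` matters: its fibres have two vertices, so they can pass token `1` to the rest
  -- of `Q ∩ B`.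
  obtain ⟨J, -, hJQ, hJi, hJm⟩ := H.exists_maximal_independent (I := ∅) (X := Q ∩ B)
    (Set.empty_subset _) (by simp)
  obtain ⟨O, hJO, hOQ, hOi, hOm⟩ := H.exists_maximal_independent
    (hJQ.trans Set.inter_subset_left) hJi
  have hc0 : ∀ w, ∃ c, w ∉ P → G.IsTokenSet K v (f w) c ∧ ((∃ x ∈ f w, G.Adj v x) → 0 ∈ c) := by
    intro w
    by_cases hw : ∃ x ∈ f w, G.Adj v x
    · by_cases hwP : w ∈ P
      · exact ⟨∅, fun e => absurd hwP e⟩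
      · simp only [hP, Set.mem_ofPred_eq, IsPoor, not_and, not_forall, not_not] at hwP
        obtain ⟨c, hc, h0⟩ := hwP hw
        exact ⟨c, fun _ => ⟨hc, fun _ => h0⟩⟩
    · obtain ⟨c, hc⟩ := h.exists_isTokenSet (f := f w) fun x hx hvx => hw ⟨x, hx, hvx⟩
      exact ⟨c, fun _ => ⟨hc, fun e => absurd e hw⟩⟩
  choose c0 hc0 using hc0
  set R : Set W := {w | w ∈ P ∧ w ∉ Q ∧ ∃ w', H.Adj w' w ∧ 0 ∈ c0 w'} with hR
  set L : Set W := {w | w ∈ P ∧ w ∈ B ∧ w ∉ Q ∧ w ∉ R ∧ ∀ w', H.Adj w' w → 1 ∉ c0 w'} with hL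
  set c : W → Finset (Fin 3) := fun w =>
    if w ∈ P then
      if w ∈ O ∨ w ∈ R then if (f w).card = 1 then {2} else {1, 2}
      else if w ∈ L then {0}
      else if (f w).card = 1 then {0} else if w ∈ B then {0, 2} else {0, 1}
    else c0 w with hcdef
  have hcN : ∀ {w}, w ∉ P → c w = c0 w := fun {w} hw => by simp [hcdef, hw]
  have hcL : ∀ {w}, w ∈ L → c w = {0} := fun {w} hw => by
    have h1 : w ∉ O := fun e => hw.2.2.1 (hOQ e)
    simp [hcdef, hw, hw.1, h1, hw.2.2.2.1]
  have hcases : ∀ {w}, w ∈ P → (∃ x, G.Adj v x ∧ f w = {x} ∧ w ∉ B ∧ (f w).card = 1) ∨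
      ∃ x y, G.Adj v x ∧ x ≠ y ∧ y ≠ v ∧ f w = {x, y} ∧ (∀ k ∈ K, G.Covers (f w) k) ∧
        (f w).card = 2 ∧ (y ∈ G.far K v ∧ w ∈ B ∨ w ∉ B ∧ ∀ s ∈ G.far K v, G.Covers (f w) s) := by
    intro w hw
    rcases h.isPoor_cases hw with ⟨x, hvx, hx⟩ | ⟨x, y, hvx, hxy, hyv, hfw, hk, hy⟩
    · refine Or.inl ⟨x, hvx, hx, ?_, by simp [hx]⟩
      rintro ⟨s, hs, hsf⟩
      rw [hx, Finset.mem_singleton] at hsf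
      exact hs.2.1 (hsf ▸ hvx)
    · refine Or.inr ⟨x, y, hvx, hxy, hyv, hfw, hk, by simp [hfw, Finset.card_pair hxy], ?_⟩
      refine hy.imp (fun hy => ⟨hy, y, hy, by simp [hfw]⟩) fun ⟨hyS, hs⟩ => ⟨?_, hs⟩
      rintro ⟨s, hs, hsf⟩
      rw [hfw, Finset.mem_insert, Finset.mem_singleton] at hsf
      rcases hsf with rfl | rfl
      exacts [hs.2.1 hvx, hyS hs]
  have hcO : ∀ {w}, w ∈ O ∨ w ∈ R → 2 ∈ c w ∧ ((f w).card = 2 → 1 ∈ c w) := fun {w} hw => by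
    have hwP : w ∈ P := hw.elim (fun e => (hOQ e).1) fun e => e.1
    simp only [hcdef, hwP, hw, if_true]
    split_ifs with h1
    · simp [h1]
    · simp
  have hcI : ∀ {w}, w ∈ P → ¬ (w ∈ O ∨ w ∈ R) → 0 ∈ c w ∧ (w ∉ L → (f w).card = 2 →
      (w ∈ B → 2 ∈ c w) ∧ (w ∉ B → 1 ∈ c w)) := fun {w} hwP hw => by
    by_cases hwL : w ∈ L
    · simp [hcL hwL, hwL]
    · simp only [hcdef, hwP, hw, hwL, if_true, if_false]
      split_ifs with h1 h2
      · simp [h1]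
      · simp [h2]
      · simp [h2]
  have hcov : ∀ {w g}, ¬ G.Covers (f w) g → ∃ w', H.Adj w' w ∧ g ∈ f w' := fun {w g} hg => by
    rcases hf w g with h1 | h1 | h1
    exacts [absurd (Or.inl h1) hg, absurd (Or.inr h1) hg, h1]
  have prov0 : ∀ {w}, v ∈ f w → 0 ∈ c w := by
    intro w hw
    by_cases hwP : w ∈ P
    · rcases hcases hwP with ⟨x, hvx, hx, -⟩ | ⟨x, y, hvx, -, hyv, hfw, -⟩
      · rw [hx, Finset.mem_singleton] at hw
        exact absurd hw hvx.ne
      · rw [hfw, Finset.mem_insert, Finset.mem_singleton] at hw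
        exact (hw.elim hvx.ne hyv.symm).elim
    · rw [hcN hwP]
      exact (hc0 w hwP).1.zero_mem hw
  have prov1 : ∀ {w k}, k ∈ K → k ∈ f w → 1 ∈ c w := by
    intro w k hk hw
    by_cases hwP : w ∈ P
    · rcases hcases hwP with ⟨x, hvx, hx, -⟩ | ⟨x, y, hvx, -, hyv, hfw, -, h2, hB'⟩
      · rw [hx, Finset.mem_singleton] at hw
        exact absurd hvx (h.not_adj x (hw ▸ hk))
      · rw [hfw, Finset.mem_insert, Finset.mem_singleton] at hw
        rcases hw with rfl | rfl
        · exact absurd hvx (h.not_adj k hk)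
        · rcases hB' with ⟨hS, -⟩ | ⟨hnB, -⟩
          · exact absurd hk hS.2.2
          · by_cases hO : w ∈ O ∨ w ∈ R
            · exact (hcO hO).2 h2
            · exact ((hcI hwP hO).2 (fun e => hnB e.2.1) h2).2 hnB
    · rw [hcN hwP]
      exact (hc0 w hwP).1.one_mem k hk hw
  have prov2 : ∀ {w s}, s ∈ G.far K v → s ∈ f w → w ∉ L → 2 ∈ c w := by
    intro w s hs hw hwL
    by_cases hwP : w ∈ P
    · by_cases hO : w ∈ O ∨ w ∈ R
      · exact (hcO hO).1
      have hwB : w ∈ B := ⟨s, hs, hw⟩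
      rcases hcases hwP with ⟨x, -, -, hnB, -⟩ | ⟨x, y, -, -, -, -, -, h2, -⟩
      · exact absurd hwB hnB
      · exact ((hcI hwP hO).2 hwL h2).1 hwB
    · rw [hcN hwP]
      exact (hc0 w hwP).1.two_mem s hs hw
  have hPN : ∀ {w w'}, w ∈ P → w ∉ Q → H.Adj w' w → w' ∉ P := fun hw hwQ hww' hw' =>
    hwQ ⟨hw, _, hw', hww'⟩
  have hLP : ∀ {w}, w ∈ L → w ∈ P := fun hw => hw.1
  -- The neighbouring fibre containing `m` is not poor. Were `m` a neighbour of `v`, that fibre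
  -- would carry token `0` and `w` would lie in `R`; hence `m` is far.
  have hnear : ∀ {w x}, w ∈ P → G.Adj v x → x ∈ f w → w ∉ Q → w ∉ R → ∀ {m}, ¬ G.Covers (f w) m →
      m ∉ K → m ∈ G.far K v ∧ ∃ w', H.Adj w' w ∧ 2 ∈ c w' := by
    intro w x hw hvx hx hwQ hwR m hm hmK
    obtain ⟨w', hw', hmw'⟩ := hcov hm
    have hw'P := hPN hw hwQ hw'
    have hmS : m ∈ G.far K v := by
      rcases mem_or_adj_or_mem_far (G := G) (K := K) (v := v) m with rfl | hvm | hmK' | hmS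
      · exact absurd (Or.inr ⟨x, hx, hvx.symm⟩) hm
      · exact absurd ⟨hw, hwQ, w', hw', (hc0 w' hw'P).2 ⟨m, hmw', hvm⟩⟩ hwR
      · exact absurd hmK' hmK
      · exact hmS
    exact ⟨hmS, w', hw', prov2 hmS hmw' fun e => hw'P (hLP e)⟩
  have hLfacts : ∀ {l}, l ∈ L → (∀ s ∈ G.far K v, ∀ t ∈ G.far K v, s ∈ f l → t ∈ f l → s = t) ∧
      (∃ s ∈ G.far K v, s ∉ f l) ∧ (f l).card = 2 ∧ ∃ w', H.Adj w' l ∧ 2 ∈ c w' := by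
    intro l hl
    obtain ⟨hlP, hlB, hlQ, hlR, -⟩ := hl
    rcases hcases hlP with ⟨x, -, -, hnB, -⟩ | ⟨x, y, hvx, hxy, hyv, hfw, hk, h2, hy⟩
    · exact absurd hlB hnB
    obtain ⟨m, hmx, hmy, hmx', hmy'⟩ := h.miss x y
    have hm : ¬ G.Covers (f l) m := by
      rw [hfw]
      exact not_covers_pair.2 ⟨⟨hmx, hmy⟩, fun e => hmx' e.symm, fun e => hmy' e.symm⟩
    obtain ⟨hmS, hw⟩ := hnear hlP hvx (by simp [hfw]) hlQ hlR hm fun e => hm (hk m e)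
    refine ⟨fun s hs t ht hsl htl => ?_, ⟨m, hmS, fun e => hm (Or.inl e)⟩, h2, hw⟩
    have key : ∀ {s}, s ∈ G.far K v → s ∈ f l → s = y := fun {s} hs hsl => by
      rw [hfw, Finset.mem_insert, Finset.mem_singleton] at hsl
      exact hsl.resolve_left fun e => hs.2.1 (e ▸ hvx)
    rw [key hs hsl, key ht htl]
  refine ⟨c, L, ?_, ?_, ?_, ?_, ?_, fun l hl => ⟨(hLfacts hl).1, (hLfacts hl).2.1⟩⟩
  · intro w
    by_cases hwP : w ∈ P
    · have h12 : (f w).card = 1 ∨ (f w).card = 2 :=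
        (hcases hwP).imp (fun ⟨_, _, _, _, e⟩ => e) fun ⟨_, _, _, _, _, _, _, e, _⟩ => e
      simp only [hcdef, hwP, if_true]
      split_ifs with h1 h2 h3 h4 h5
      · simp [h2]
      · simp [h12.resolve_left h2]
      · rw [Finset.card_singleton]
        omega
      · simp [h4]
      · simp [h12.resolve_left h4]
      · simp [h12.resolve_left h4]
    · rw [hcN hwP]
      exact (hc0 w hwP).1.card_le
  · intro w hw
    simp [hcL hw, (hLfacts hw).2.2.1]
  · intro w
    by_cases hwP : w ∈ P
    · by_cases hO : w ∈ O ∨ w ∈ R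
      · right
        rcases hO with hO | ⟨-, hwQ, w', hw', h0⟩
        · obtain ⟨-, w', hw', hww'⟩ := hOQ hO
          have hw'Q : w' ∈ Q := ⟨hw', w, hwP, hww'.symm⟩
          refine ⟨w', hww', (hcI hw' ?_).1⟩
          rintro (e | e)
          exacts [hOi w' e w hO hww', e.2.1 hw'Q]
        · exact ⟨w', hw', by rwa [hcN (hPN hwP hwQ hw')]⟩
      · exact Or.inl (hcI hwP hO).1
    · by_contra! hn
      rw [hcN hwP] at hn
      obtain ⟨w', hw', hv⟩ := hcov ((hc0 w hwP).1.zero_cov hn.1)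
      exact hn.2 w' hw' (prov0 hv)
  · intro w hwL
    by_cases hwP : w ∈ P
    · rcases hcases hwP with ⟨x, hvx, hfx, -⟩ | ⟨x, y, -, -, -, -, -, h2, -⟩
      · obtain ⟨k, hk, hkx, hxk⟩ := h.exists_mem (x := x) fun e => h.not_adj x e hvx
        obtain ⟨w', hw', hkw'⟩ := hcov (w := w) (g := k) (by
          rw [hfx]
          exact not_covers_singleton.2 ⟨hkx, hxk⟩)
        exact Or.inr ⟨w', hw', prov1 hk hkw'⟩
      · by_cases hO : w ∈ O ∨ w ∈ R
        · exact Or.inl ((hcO hO).2 h2)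
        rw [not_or] at hO
        by_cases hwB : w ∈ B
        · right
          by_cases hwQ : w ∈ Q
          · obtain ⟨o, ho, how⟩ := hJm w ⟨hwQ, hwB⟩ fun e => hO.1 (hJO e)
            refine ⟨o, how, (hcO (Or.inl (hJO ho))).2 ?_⟩
            rcases hcases (hOQ (hJO ho)).1 with ⟨_, -, -, hnB, -⟩ | ⟨_, _, -, -, -, -, -, h2, -⟩
            exacts [absurd (hJQ ho).2 hnB, h2]
          · by_contra! hn
            exact hwL ⟨hwP, hwB, hwQ, hO.2, fun w' hw' e => hn w' hw' (by
              rwa [hcN (hPN hwP hwQ hw')])⟩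
        · exact Or.inl (((hcI hwP (not_or.2 hO)).2 hwL h2).2 hwB)
    · by_contra! hn
      rw [hcN hwP] at hn
      obtain ⟨k, hk, hkc⟩ := (hc0 w hwP).1.one_cov hn.1
      obtain ⟨w', hw', hkw'⟩ := hcov hkc
      exact hn.2 w' hw' (prov1 hk hkw')
  · intro w
    by_cases hwP : w ∈ P
    · left
      by_cases hO : w ∈ O ∨ w ∈ R
      · exact Or.inl (hcO hO).1
      by_cases hwL : w ∈ L
      · exact Or.inr (hLfacts hwL).2.2.2
      by_cases hwQ : w ∈ Q
      · obtain ⟨o, ho, how⟩ := hOm w hwQ fun e => hO (Or.inl e)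
        exact Or.inr ⟨o, how, (hcO (Or.inl ho)).1⟩
      rcases hcases hwP with ⟨x, hvx, hfx, -⟩ | ⟨x, y, hvx, hxy, hyv, hfw, hk, h2, hy⟩
      · obtain ⟨k, hk, hkx, hxk⟩ := h.exists_mem (x := x) fun e => h.not_adj x e hvx
        obtain ⟨m, hmx, hmk, hmx', hmk'⟩ := h.miss x k
        refine Or.inr (hnear hwP hvx (by simp [hfx]) hwQ (fun e => hO (Or.inr e)) (m := m) ?_
          fun e => hmk' (h.clique.adj e hk hmk)).2
        rw [hfx]
        exact not_covers_singleton.2 ⟨hmx, fun e => hmx' e.symm⟩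
      · rcases hy with ⟨-, hwB⟩ | ⟨hwB, hS⟩
        · exact Or.inl (((hcI hwP hO).2 hwL h2).1 hwB)
        · obtain ⟨m, hmx, hmy, hmx', hmy'⟩ := h.miss x y
          have hm : ¬ G.Covers (f w) m := by
            rw [hfw]
            exact not_covers_pair.2 ⟨⟨hmx, hmy⟩, fun e => hmx' e.symm, fun e => hmy' e.symm⟩
          exact absurd (hS m (hnear hwP hvx (by simp [hfw]) hwQ (fun e => hO (Or.inr e)) hm
            fun e => hm (hk m e)).1) hm
    · by_contra! hn
      obtain ⟨⟨hn1, hn2⟩, s, hs, hns⟩ := hn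
      have hc := (hc0 w hwP).1
      rw [← hcN hwP] at hc
      obtain ⟨t, ht, hct⟩ := hc.two_cov hn1
      have key : ∀ {t}, t ∈ G.far K v → ¬ G.Covers (f w) t → ∃ l ∈ L, H.Adj w l ∧ t ∈ f l := by
        intro t ht hct
        obtain ⟨l, hl, htl⟩ := hcov hct
        exact ⟨l, not_not.1 fun e => hn2 l hl (prov2 ht htl e), hl.symm, htl⟩
      obtain ⟨l, hlL, hwl, -⟩ := key ht hct
      -- A vertex of `f w` would give `w` a token `0` or `1`, which is barred next to `l ∈ L`, or
      -- the missing token `2`. An empty fibre leaves every far vertex to be supplied from `L`.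
      have hempty : ∀ x, x ∉ f w := by
        intro x hx
        rcases mem_or_adj_or_mem_far (G := G) (K := K) (v := v) x with rfl | hvx | hxK | hxS
        · exact hlL.2.2.2.1 ⟨hlL.1, hlL.2.2.1, w, hwl, (hc0 w hwP).1.zero_mem hx⟩
        · exact hlL.2.2.2.1 ⟨hlL.1, hlL.2.2.1, w, hwl, (hc0 w hwP).2 ⟨x, hx, hvx⟩⟩
        · exact hlL.2.2.2.2 w hwl ((hc0 w hwP).1.one_mem x hxK hx)
        · exact hn1 (hc.two_mem x hxS hx)
      obtain ⟨l, hlL, hwl, hsl⟩ := key hs fun e => e.elim (hempty s) fun ⟨x, hx, _⟩ => hempty x hx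
      exact hns l hlL hwl hsl

theorem three_mul_dominationNumber_le_sum [Fintype W] (h : G.IsAnchor K v)
    (hf : G.FibrewiseDominates H f) : 3 * H.dominationNumber ≤ ∑ w, (f w).card := by
  classical
  obtain ⟨c, L, hc, hcL, h0, h1, h2, hL⟩ := h.exists_token_assignment hf
  set L' : Finset W := Finset.univ.filter fun w => w ∈ L with hL'
  have hmemL : ∀ {w}, w ∈ L' ↔ w ∈ L := by simp [hL']
  obtain ⟨A, C, hAC, hA, hC⟩ : ∃ A C : Finset W, A.card + C.card ≤ L'.card ∧
      (∀ l ∈ L', l ∈ A ∨ ∃ a ∈ A, H.Adj a l) ∧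
      ∀ w, (2 ∈ c w ∨ ∃ w', H.Adj w' w ∧ 2 ∈ c w') ∨ ∃ a ∈ C, H.Adj a w := by
    by_cases hE : ∀ w, 2 ∈ c w ∨ ∃ w', H.Adj w' w ∧ 2 ∈ c w'
    · exact ⟨L', ∅, by simp, fun l hl => Or.inl hl, fun w => Or.inl (hE w)⟩
    push Not at hE
    obtain ⟨e, he, he'⟩ := hE
    have hE : ∀ w, ¬ (2 ∈ c w ∨ ∃ w', H.Adj w' w ∧ 2 ∈ c w') →
      ∀ s ∈ G.far K v, ∃ l ∈ L, H.Adj w l ∧ s ∈ f l := fun w => (h2 w).resolve_left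
    obtain ⟨k, hk, -⟩ := h.exists_mem h.notMem
    obtain ⟨s, hs, -⟩ := h.exists_far hk
    obtain ⟨l, hl, -, hsl⟩ := hE e (by
      rintro (h6 | ⟨w', h6, h7⟩)
      exacts [he h6, he' w' h6 h7]) s hs
    -- Since a fibre over `L` has at most one far vertex, those containing `s` and those containing
    -- `t` are disjoint families, and a vertex undominated for token `2` has neighbours in both.
    obtain ⟨t, ht, htl⟩ := (hL l hl).2
    obtain ⟨A, C, h3, h4, h5⟩ := H.exists_dominating_pair (L := L')
      (L₁ := L'.filter fun l => s ∈ f l) (L₂ := L'.filter fun l => t ∈ f l)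
      (E := {w | ¬ (2 ∈ c w ∨ ∃ w', H.Adj w' w ∧ 2 ∈ c w')})
      (Finset.filter_subset _ _) (Finset.filter_subset _ _) (Finset.disjoint_left.2 fun m h5 h6 => by
        simp only [Finset.mem_filter, hmemL] at h5 h6
        exact htl ((hL m h5.1).1 s hs t ht h5.2 h6.2 ▸ hsl))
      (fun w hw => by
        obtain ⟨m, hm, hwm, hsm⟩ := hE w hw s hs
        exact ⟨m, by simp [hmemL, hm, hsm], hwm⟩)
      (fun w hw => by
        obtain ⟨m, hm, hwm, hsm⟩ := hE w hw t ht
        exact ⟨m, by simp [hmemL, hm, hsm], hwm⟩)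
    exact ⟨A, C, h3, h4, fun w => or_iff_not_imp_left.2 (h5 w)⟩
  have b0 : H.dominationNumber ≤ (Finset.univ.filter fun w => 0 ∈ c w).card :=
    dominationNumber_le_card fun w => (h0 w).imp (by simp) fun ⟨w', e1, e2⟩ => ⟨w', by simpa, e1⟩
  have b1 : H.dominationNumber ≤ ((Finset.univ.filter fun w => 1 ∈ c w) ∪ A).card :=
    dominationNumber_le_card fun w => by
      by_cases hw : w ∈ L
      · exact (hA w (hmemL.2 hw)).imp (Finset.mem_union_right _)
          fun ⟨a, e1, e2⟩ => ⟨a, Finset.mem_union_right _ e1, e2⟩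
      · exact (h1 w hw).imp (fun e => Finset.mem_union_left _ (by simpa))
          fun ⟨w', e1, e2⟩ => ⟨w', Finset.mem_union_left _ (by simpa), e1⟩
  have b2 : H.dominationNumber ≤ ((Finset.univ.filter fun w => 2 ∈ c w) ∪ C).card :=
    dominationNumber_le_card fun w => by
      rcases hC w with (e | ⟨w', e1, e2⟩) | ⟨a, e1, e2⟩
      · exact Or.inl (Finset.mem_union_left _ (by simpa))
      · exact Or.inr ⟨w', Finset.mem_union_left _ (by simpa), e1⟩
      · exact Or.inr ⟨a, Finset.mem_union_right _ e1, e2⟩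
  have b3 := sum_card_tokens c
  rw [Fin.sum_univ_three] at b3
  -- The spare tokens over `L` pay for the repairs: `A` for token `1` and `C` for token `2`.
  have b4 : ∑ w, (c w).card + L'.card ≤ ∑ w, (f w).card := by
    rw [hL', Finset.card_filter, ← Finset.sum_add_distrib]
    refine Finset.sum_le_sum fun w _ => ?_
    split_ifs with e
    exacts [hcL w e, hc w]
  have b5 := Finset.card_union_le (Finset.univ.filter fun w => 1 ∈ c w) A
  have b6 := Finset.card_union_le (Finset.univ.filter fun w => 2 ∈ c w) C
  omega

end IsAnchor

end Assignment
end SimpleGraph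

/-! ### Vizing's inequality and the conclusion. -/

namespace SimpleGraph

/-- Vizing's inequality for connected `P₅`-free, `K₄`-free graphs. -/
theorem InducedFree.mul_dominationNumber_le {V W : Type*} [Fintype V] [Fintype W]
    {G : SimpleGraph V} (hG : G.Connected) (hP5 : (pathGraph 5).InducedFree G)
    (hK4 : (completeGraph (Fin 4)).InducedFree G) (H : SimpleGraph W) :
    G.dominationNumber * H.dominationNumber ≤ (G.boxProd H).dominationNumber := by
  classical
  obtain ⟨D, hD, hcard⟩ := (G.boxProd H).exists_isGammaSet
  have hf := hD.fibrewiseDominates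
  rw [← hcard, ← sum_card_fibre D]
  have := hG.nonempty
  have h3 : G.dominationNumber ≤ 3 := InducedFree.dominationNumber_le hG hP5 le_rfl hK4
  have hmiss : ∀ x y, ({x, y} : Finset V).card < G.dominationNumber →
      ∃ z, z ≠ x ∧ z ≠ y ∧ ¬ G.Adj z x ∧ ¬ G.Adj z y := by
    intro x y hxy
    by_contra! hn
    refine hxy.not_ge (SimpleGraph.dominationNumber_le fun z => ?_)
    by_cases h1 : z = x
    · exact ⟨x, by simp, mem_closedNbhd.2 (Or.inl h1)⟩
    by_cases h2 : z = y
    · exact ⟨y, by simp, mem_closedNbhd.2 (Or.inl h2)⟩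
    by_cases h4 : G.Adj z x
    · exact ⟨x, by simp, mem_closedNbhd.2 (Or.inr h4.symm)⟩
    · exact ⟨y, by simp, mem_closedNbhd.2 (Or.inr (hn z h1 h2 h4).symm)⟩
  have hcases : G.dominationNumber ≤ 1 ∨ G.dominationNumber = 2 ∨ G.dominationNumber = 3 := by
    omega
  rcases hcases with h | h | h
  · exact (Nat.mul_le_mul_right _ h).trans (by simpa using hf.dominationNumber_le_sum)
  · rw [h]
    refine hf.two_mul_dominationNumber_le_sum fun x => ?_
    obtain ⟨z, hz, -, hzx, -⟩ := hmiss x x (by simp [h])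
    exact ⟨z, hz, fun e => hzx e.symm⟩
  · rw [h]
    have hmiss' : ∀ x y, ∃ z, z ≠ x ∧ z ≠ y ∧ ¬ G.Adj z x ∧ ¬ G.Adj z y := fun x y =>
      hmiss x y (h ▸ Finset.card_le_two.trans_lt (by norm_num))
    obtain ⟨K, v, hK, hv, hvK⟩ := exists_isMaxClique_anticomplete hG hP5.exists_chord hK4.not_adj
      hmiss'
    exact (IsAnchor.mk hK hv hvK hmiss').three_mul_dominationNumber_le_sum hf

end SimpleGraph

theorem mainTheorem2 {V : Type*} [Fintype V] (G : SimpleGraph V) (hG : G.Connected)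
    (hP5 : SimpleGraph.InducedFree (SimpleGraph.pathGraph 5) G) :
    (SimpleGraph.InducedFree (SimpleGraph.completeGraph (Fin 4)) G →
      ∀ (W : Type*) [Fintype W] (H : SimpleGraph W),
        G.dominationNumber * H.dominationNumber ≤ (G.boxProd H).dominationNumber) ∧
    (∀ r : ℕ, 4 < r → SimpleGraph.InducedFree (SimpleGraph.completeGraph (Fin r)) G →
      G.power ≤ r - 1) := by
  exact ⟨fun hK4 W _ H => SimpleGraph.InducedFree.mul_dominationNumber_le hG hP5 hK4 H,
    fun r hr hK => G.power_le_dominationNumber.trans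
      (SimpleGraph.InducedFree.dominationNumber_le hG hP5 hr.le hK)⟩
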